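/- Let $n,m_1,m_2\in\mathbb N_0$, $m=m_1+m_2$, and let $j=\operatorname{diag}(I_{m_1},-I_{m_2})$, $P_1=(I_m+j)/2$, $P_2=(I_m-j)/2$. A quadruple $\Sigma=\{\alpha,S,\vartheta_1,\vartheta_2\}$ consists of complex matrices of sizes $n\times n$, $n\times n$, $n\times m_1$, $n\times m_2$; write $\Lambda=[\vartheta_1\ \ \vartheta_2]$. It is called strongly admissible if $S>0$ (positive definite), $\alpha S-S\alpha^*=i(\vartheta_1\vartheta_1^*+\vartheta_2\vartheta_2^*)$, and the pair $\{\alpha,\vartheta_1\}$ is controllable, that is, $\operatorname{Span}\bigcup_{\nu=0}^{n-1}\operatorname{Im}(\alpha^\nu\vartheta_1)=\mathbb C^n$. Its transfer function is $$W_\Sigma(z)=I_m+i\Lambda^*S^{-1}(zI_n-\alpha)^{-1}\Lambda .$$ **Theorem.** Let $\Sigma_{0,0}=\{\alpha,S_0,\vartheta_1,\vartheta_2\}$ be a strongly admissible quadruple with $i\notin\sigma(\alpha)$. Then $0,-i\notin\sigma(\alpha)$, and there is exactly one family of quadruples $\Sigma_{t,0}=\{\alpha,S_0(t),\vartheta_1(t),\vartheta_2(t)\}$,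 $t\in\mathbb R$, that equals $\Sigma_{0,0}$ at $t=0$ and for which $\Lambda_0(t)=[\vartheta_1(t)\ \ \vartheta_2(t)]$ and $S_0(t)$ satisfy on $\mathbb R$ $$\frac{d}{dt}\Lambda_0=-2\big((\alpha-iI_n)^{-1}\Lambda_0P_1+(\alpha+iI_n)^{-1}\Lambda_0P_2\big),$$ $$\frac{d}{dt}S_0=-\Big((\alpha-iI_n)^{-1}S_0+(\alpha+iI_n)^{-1}S_0+S_0(\alpha^*+iI_n)^{-1}+S_0(\alpha^*-iI_n)^{-1}+2(\alpha^2+I_n)^{-1}\big(\alpha\Lambda_0j\Lambda_0^*+\Lambda_0j\Lambda_0^*\alpha^*\big)((\alpha^*)^2+I_n)^{-1}\Big).$$ For $k\in\mathbb N_0$ define the quadruples $\Sigma_{t,k}=\{\alpha,S_k(t),(I_n+i\alpha^{-1})^k\vartheta_1(t),(I_n-i\alpha^{-1})^k\vartheta_2(t)\}$ by $$\Lambda_{k+1}=\Lambda_k+i\alpha^{-1}\Lambda_kj,\qquad S_{k+1}=S_k+\alpha^{-1}S_k(\alpha^{-1})^*+\alpha^{-1}\Lambda_kj\Lambda_k^*(\alpha^{-1})^*.$$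 Then $\Sigma_{t,k}$ is strongly admissible for all $t\in\mathbb R$ and $k\in\mathbb N_0$. Moreover, the matrix functions $$C_k(t)=j+\Lambda_k(t)^*S_k(t)^{-1}\Lambda_k(t)-\Lambda_{k+1}(t)^*S_{k+1}(t)^{-1}\Lambda_{k+1}(t),$$ $$H_k^+(t)=W_{\Sigma_{t,k}}(i)(I_m+j)W_{\Sigma_{t,k}}(-i)^*,\qquad H_k^-(t)=W_{\Sigma_{t,k}}(-i)(I_m-j)W_{\Sigma_{t,k}}(i)^*$$ are well-defined and solve the generalized discrete Heisenberg magnet model: for all $t\in\mathbb R$ and $k\in\mathbb N_0$, $C_k$ is differentiable at $t$, $$i\frac{d}{dt}C_k(t)=\big(H_{k+1}^-(t)-H_{k+1}^+(t)\big)C_k(t)-C_k(t)\big(H_k^-(t)-H_k^+(t)\big),$$ $$(I_m+C_k(t))H_k^-(t)=H_{k+1}^-(t)(I_m+C_k(t))=0,\qquad (I_m-C_k(t))H_k^+(t)=H_{k+1}^+(t)(I_m-C_k(t))=0,$$ and $C_k(t)=U_k(t)jU_k(t)^*$ for some unitary $m\times m$ matrix $U_k(t)$. -/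

import Mathlib

open scoped Matrix ComplexOrder

/-- A quadruple `{α, S, ϑ₁, ϑ₂}` of complex matrices of sizes `n × n`, `n × n`, `n × m₁`,
`n × m₂`. -/
@[ext]
structure Quadruple (n m₁ m₂ : ℕ) where
  /-- The main matrix. -/
  α : Matrix (Fin n) (Fin n) ℂ
  /-- The positive definite matrix. -/
  S : Matrix (Fin n) (Fin n) ℂ
  /-- The first block of columns. -/
  ϑ₁ : Matrix (Fin n) (Fin m₁) ℂ
  /-- The second block of columns. -/
  ϑ₂ : Matrix (Fin n) (Fin m₂) ℂ

/-- The signature matrix `j = diag (I_{m₁}, -I_{m₂})`. -/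
def sgn (m₁ m₂ : ℕ) : Matrix (Fin m₁ ⊕ Fin m₂) (Fin m₁ ⊕ Fin m₂) ℂ :=
  Matrix.fromBlocks 1 0 0 (-1)

/-- `P₁ = (I_m + j) / 2`. -/
noncomputable def proj₁ (m₁ m₂ : ℕ) : Matrix (Fin m₁ ⊕ Fin m₂) (Fin m₁ ⊕ Fin m₂) ℂ :=
  (1 / 2 : ℂ) • (1 + sgn m₁ m₂)

/-- `P₂ = (I_m - j) / 2`. -/
noncomputable def proj₂ (m₁ m₂ : ℕ) : Matrix (Fin m₁ ⊕ Fin m₂) (Fin m₁ ⊕ Fin m₂) ℂ :=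
  (1 / 2 : ℂ) • (1 - sgn m₁ m₂)

/-- The pair `{α, ϑ}` is controllable: the images of `α ^ ν * ϑ`, `0 ≤ ν ≤ n - 1`, span `ℂⁿ`. -/
def Controllable {n m : ℕ} (α : Matrix (Fin n) (Fin n) ℂ) (ϑ : Matrix (Fin n) (Fin m) ℂ) : Prop :=
  (⨆ ν : Fin n, LinearMap.range (α ^ (ν : ℕ) * ϑ).mulVecLin) = ⊤

namespace Quadruple

variable {n m₁ m₂ : ℕ}

/-- `Λ = [ϑ₁ ϑ₂]`. -/
def Lam (Q : Quadruple n m₁ m₂) : Matrix (Fin n) (Fin m₁ ⊕ Fin m₂) ℂ :=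
  Matrix.fromCols Q.ϑ₁ Q.ϑ₂

/-- Admissibility: `S > 0` and `α S - S α* = i (ϑ₁ ϑ₁* + ϑ₂ ϑ₂*)`. -/
def Admissible (Q : Quadruple n m₁ m₂) : Prop :=
  Q.S.PosDef ∧
    Q.α * Q.S - Q.S * Q.αᴴ = Complex.I • (Q.ϑ₁ * Q.ϑ₁ᴴ + Q.ϑ₂ * Q.ϑ₂ᴴ)

/-- Strong admissibility: admissible, with `{α, ϑ₁}` controllable. -/
def StronglyAdmissible (Q : Quadruple n m₁ m₂) : Prop :=
  Q.Admissible ∧ Controllable Q.α Q.ϑ₁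

/-- The transfer function `W_Σ(z) = I_m + i Λ* S⁻¹ (z I_n - α)⁻¹ Λ`. -/
noncomputable def transfer (Q : Quadruple n m₁ m₂) (z : ℂ) :
    Matrix (Fin m₁ ⊕ Fin m₂) (Fin m₁ ⊕ Fin m₂) ℂ :=
  1 + Complex.I • (Q.Lamᴴ * Q.S⁻¹ * (z • 1 - Q.α)⁻¹ * Q.Lam)

/-- One step of the discrete evolution `Σ_k ↦ Σ_{k+1}`. -/
noncomputable def next (Q : Quadruple n m₁ m₂) : Quadruple n m₁ m₂ where
  α := Q.α
  S := Q.S + Q.α⁻¹ * Q.S * (Q.α⁻¹)ᴴ + Q.α⁻¹ * Q.Lam * sgn m₁ m₂ * Q.Lamᴴ * (Q.α⁻¹)ᴴ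
  ϑ₁ := (1 + Complex.I • Q.α⁻¹) * Q.ϑ₁
  ϑ₂ := (1 - Complex.I • Q.α⁻¹) * Q.ϑ₂

/-- The discrete evolution in terms of `Λ`: `Λ_{k+1} = Λ_k + i α⁻¹ Λ_k j`. -/
theorem lam_next (Q : Quadruple n m₁ m₂) :
    Q.next.Lam = Q.Lam + Complex.I • (Q.α⁻¹ * Q.Lam * sgn m₁ m₂) := by
  simp only [Lam, next, sgn, Matrix.mul_fromCols, Matrix.fromCols_mul_fromBlocks]
  ext a (b | b) <;> simp [Matrix.add_mul, sub_eq_add_neg]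

/-- The quadruples `Σ_k` determined by `Σ_0 = Q`. -/
noncomputable def seq (Q : Quadruple n m₁ m₂) : ℕ → Quadruple n m₁ m₂
  | 0 => Q
  | k + 1 => (seq Q k).next

/-- The pseudo-exponential potential generated by `Σ_0 = Q`:
`C_k = j + Λ_k* S_k⁻¹ Λ_k - Λ_{k+1}* S_{k+1}⁻¹ Λ_{k+1}`. -/
noncomputable def potential (Q : Quadruple n m₁ m₂) (k : ℕ) :
    Matrix (Fin m₁ ⊕ Fin m₂) (Fin m₁ ⊕ Fin m₂) ℂ :=
  sgn m₁ m₂ + (Q.seq k).Lamᴴ * (Q.seq k).S⁻¹ * (Q.seq k).Lam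
    - (Q.seq (k + 1)).Lamᴴ * (Q.seq (k + 1)).S⁻¹ * (Q.seq (k + 1)).Lam

/-- `W_Σ(i) (I_m + j) W_Σ(-i)*`. -/
noncomputable def Hplus (Q : Quadruple n m₁ m₂) : Matrix (Fin m₁ ⊕ Fin m₂) (Fin m₁ ⊕ Fin m₂) ℂ :=
  Q.transfer Complex.I * (1 + sgn m₁ m₂) * (Q.transfer (-Complex.I))ᴴ

/-- `W_Σ(-i) (I_m - j) W_Σ(i)*`. -/
noncomputable def Hminus (Q : Quadruple n m₁ m₂) : Matrix (Fin m₁ ⊕ Fin m₂) (Fin m₁ ⊕ Fin m₂) ℂ :=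
  Q.transfer (-Complex.I) * (1 - sgn m₁ m₂) * (Q.transfer Complex.I)ᴴ

/-- The right-hand side of the evolution equation of `Λ` in `t`. -/
noncomputable def lamRHS (Q : Quadruple n m₁ m₂) : Matrix (Fin n) (Fin m₁ ⊕ Fin m₂) ℂ :=
  (-2 : ℂ) • ((Q.α - Complex.I • 1)⁻¹ * Q.Lam * proj₁ m₁ m₂
    + (Q.α + Complex.I • 1)⁻¹ * Q.Lam * proj₂ m₁ m₂)

/-- The right-hand side of the evolution equation of `S` in `t`. -/
noncomputable def sRHS (Q : Quadruple n m₁ m₂) : Matrix (Fin n) (Fin n) ℂ :=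
  -((Q.α - Complex.I • 1)⁻¹ * Q.S + (Q.α + Complex.I • 1)⁻¹ * Q.S
    + Q.S * (Q.αᴴ + Complex.I • 1)⁻¹ + Q.S * (Q.αᴴ - Complex.I • 1)⁻¹
    + (2 : ℂ) • ((Q.α ^ 2 + 1)⁻¹
        * (Q.α * Q.Lam * sgn m₁ m₂ * Q.Lamᴴ + Q.Lam * sgn m₁ m₂ * Q.Lamᴴ * Q.αᴴ)
        * (Q.αᴴ ^ 2 + 1)⁻¹))

/-- `F t = Σ_{t,0}` is the evolution in `t ∈ ℝ` of the quadruple `Q = Σ_{0,0}`: `α` does not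
depend on `t`, while `Λ` and `S` solve the evolution equations. -/
structure IsFlow (Q : Quadruple n m₁ m₂) (F : ℝ → Quadruple n m₁ m₂) : Prop where
  init : F 0 = Q
  alpha_const : ∀ t, (F t).α = Q.α
  lam_deriv : ∀ t, HasDerivAt (fun s => (F s).Lam) (F t).lamRHS t
  s_deriv : ∀ t, HasDerivAt (fun s => (F s).S) (F t).sRHS t

end Quadruple

/-- The generalized discrete Heisenberg magnet model for the matrix functions `C_k`, `H_k^+`,
`H_k^-` of `t ∈ ℝ`, `k ∈ ℕ₀`: the evolution equation and the accompanying conditions. -/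
structure IsDGHM (m₁ m₂ : ℕ)
    (C Hp Hm : ℕ → ℝ → Matrix (Fin m₁ ⊕ Fin m₂) (Fin m₁ ⊕ Fin m₂) ℂ) : Prop where
  /-- `i (d/dt) C_k = (H_{k+1}^- - H_{k+1}^+) C_k - C_k (H_k^- - H_k^+)`. -/
  evolution : ∀ k t, ∃ D, HasDerivAt (C k) D t ∧
    Complex.I • D = (Hm (k + 1) t - Hp (k + 1) t) * C k t - C k t * (Hm k t - Hp k t)
  minus_left : ∀ k t, (1 + C k t) * Hm k t = 0
  minus_right : ∀ k t, Hm (k + 1) t * (1 + C k t) = 0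
  plus_left : ∀ k t, (1 - C k t) * Hp k t = 0
  plus_right : ∀ k t, Hp (k + 1) t * (1 - C k t) = 0
  /-- `C_k = U_k j U_k*` with `U_k` unitary. -/
  signature : ∀ k t, ∃ U ∈ Matrix.unitaryGroup (Fin m₁ ⊕ Fin m₂) ℂ, C k t = U * sgn m₁ m₂ * Uᴴ

/-! Everything rests on the Lyapunov equation $\alpha S-S\alpha^*=i\Lambda\Lambda^*$. A positive
definite solution together with controllability of $\{\alpha,\vartheta_1\}$ puts $\sigma(\alpha)$ in
the open upper half-plane (`notMem_spectrum_of_im_nonpos`), makes $X\mapsto\alpha X-X\alpha^*$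
injective (`lyapunov_injective`), and makes every Hermitian solution of a further such equation
positive definite (`posDef_of_lyapunov`). So $S$ is a function of $\Lambda$: both evolutions need
only preserve the Lyapunov equation and controllability, and positivity of $S$ is automatic. The
columns of $\Lambda$ evolve by matrix exponentials commuting with $\alpha$, and the equation for $S$
is the differentiated Lyapunov equation (`lyapunov_sRHS`).

The algebra of the model comes from the Darboux relation $W_{k+1}(z)(z-ij)=(z-iC_k)W_k(z)$
(`next_transfer_mul`) and from $W_k(z)W_k(\bar z)^*=I$. At $z=\pm i$ they give the annihilation
relations and $C_k^2=I$, and they provide a similarity between $C_k$ and $j$.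

Finally $i(\Lambda_k^*S_k^{-1}\Lambda_k)'=H_k^++H_k^--2I$ (`StronglyAdmissible.I_smul_deriv_eq`).
The difference of this identity at $k$ and $k+1$ is $iC_k'$, and the annihilation relations turn it
into the stated commutator-like form. -/

/-- Solutions of an autonomous linear differential equation are determined by their value at
`0`. -/
theorem eq_of_hasDerivAt_linear {E : Type*} [NormedAddCommGroup E] [NormedSpace ℝ E]
    [FiniteDimensional ℝ E] (T : E →ₗ[ℝ] E) {f g : ℝ → E}
    (hf : ∀ t, HasDerivAt f (T (f t)) t) (hg : ∀ t, HasDerivAt g (T (g t)) t) (h : f 0 = g 0) :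
    f = g :=
  ODE_solution_unique_univ (v := fun _ => T.toContinuousLinearMap) (s := fun _ => Set.univ)
    (t₀ := 0) (fun _ => T.toContinuousLinearMap.lipschitz.lipschitzOnWith)
    (fun t => ⟨hf t, trivial⟩) (fun t => ⟨hg t, trivial⟩) h

/-! ### Calculus of matrix functions, and unitary similarity -/

namespace Matrix

section Calculus

variable {l m n : Type*} {t : ℝ}

/-- Matrices carry only the product topology here, so the elementary rules are proved entrywise; a
norm is introduced locally where Banach space theory is used. -/
theorem hasDerivAt_iff_apply [Finite m] [Fintype n] {f : ℝ → Matrix m n ℂ} {f' : Matrix m n ℂ} :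
    HasDerivAt f f' t ↔ ∀ i j, HasDerivAt (fun s => f s i j) (f' i j) t := by
  exact (hasDerivAt_pi (φ := f) (φ' := f')).trans (forall_congr' fun i => hasDerivAt_pi)

variable [Fintype l] [Fintype m] [Fintype n]

theorem hasDerivAt_mul {f : ℝ → Matrix l m ℂ} {g : ℝ → Matrix m n ℂ}
    {f' : Matrix l m ℂ} {g' : Matrix m n ℂ} (hf : HasDerivAt f f' t) (hg : HasDerivAt g g' t) :
    HasDerivAt (fun s => f s * g s) (f' * g t + f t * g') t := by
  rw [hasDerivAt_iff_apply] at *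
  intro i j
  simp only [mul_apply, add_apply, ← Finset.sum_add_distrib]
  exact HasDerivAt.fun_sum fun k _ => (hf i k).mul (hg k j)

theorem hasDerivAt_const_mul (A : Matrix l m ℂ) {g : ℝ → Matrix m n ℂ}
    {g' : Matrix m n ℂ} (hg : HasDerivAt g g' t) :
    HasDerivAt (fun s => A * g s) (A * g') t := by
  have := hasDerivAt_mul (f := fun _ => A) (f' := 0)
    (hasDerivAt_iff_apply.2 fun i j => hasDerivAt_const t (A i j)) hg
  simpa using this

theorem hasDerivAt_mul_const {f : ℝ → Matrix l m ℂ} {f' : Matrix l m ℂ}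
    (hf : HasDerivAt f f' t) (B : Matrix m n ℂ) :
    HasDerivAt (fun s => f s * B) (f' * B) t := by
  have := hasDerivAt_mul hf (g := fun _ => B) (g' := 0)
    (hasDerivAt_iff_apply.2 fun i j => hasDerivAt_const t (B i j))
  simpa using this

theorem hasDerivAt_add {f g : ℝ → Matrix m n ℂ} {f' g' : Matrix m n ℂ}
    (hf : HasDerivAt f f' t) (hg : HasDerivAt g g' t) :
    HasDerivAt (fun s => f s + g s) (f' + g') t := by
  rw [hasDerivAt_iff_apply] at *
  exact fun i j => (hf i j).add (hg i j)

theorem hasDerivAt_sub {f g : ℝ → Matrix m n ℂ} {f' g' : Matrix m n ℂ}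
    (hf : HasDerivAt f f' t) (hg : HasDerivAt g g' t) :
    HasDerivAt (fun s => f s - g s) (f' - g') t := by
  rw [hasDerivAt_iff_apply] at *
  exact fun i j => (hf i j).sub (hg i j)

theorem hasDerivAt_const_smul (c : ℂ) {f : ℝ → Matrix m n ℂ} {f' : Matrix m n ℂ}
    (hf : HasDerivAt f f' t) : HasDerivAt (fun s => c • f s) (c • f') t := by
  rw [hasDerivAt_iff_apply] at *
  exact fun i j => (hf i j).const_mul c

theorem hasDerivAt_conjTranspose {f : ℝ → Matrix m n ℂ} {f' : Matrix m n ℂ}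
    (hf : HasDerivAt f f' t) : HasDerivAt (fun s => (f s)ᴴ) f'ᴴ t := by
  rw [hasDerivAt_iff_apply] at *
  exact fun i j => (hf j i).star

section Norm

attribute [local instance] Matrix.linftyOpNormedRing Matrix.linftyOpNormedAlgebra
  Matrix.linftyOpNormedAddCommGroup Matrix.linftyOpNormedSpace

theorem hasDerivAt_exp_smul [DecidableEq n] (A : Matrix n n ℂ) :
    HasDerivAt (fun s : ℝ => NormedSpace.exp (s • A)) (A * NormedSpace.exp (t • A)) t :=
  hasDerivAt_exp_smul_const' A t

theorem hasDerivAt_inv [DecidableEq n] {f : ℝ → Matrix n n ℂ} {f' : Matrix n n ℂ}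
    (hf : HasDerivAt f f' t) (hu : IsUnit (f t)) :
    HasDerivAt (fun s => (f s)⁻¹) (-((f t)⁻¹ * f' * (f t)⁻¹)) t := by
  obtain ⟨u, hu⟩ := hu
  have h := hasFDerivAt_ringInverse (𝕜 := ℝ) u
  rw [hu] at h
  have h2 := h.comp_hasDerivAt t hf
  simp only [nonsing_inv_eq_ringInverse]
  rw [← hu, Ring.inverse_unit]
  exact h2

theorem hasDerivAt_linearMap {p q : Type*} [Fintype p] [Fintype q]
    (T : Matrix m n ℂ →ₗ[ℂ] Matrix p q ℂ) {f : ℝ → Matrix m n ℂ} {f' : Matrix m n ℂ}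
    (hf : HasDerivAt f f' t) : HasDerivAt (fun s => T (f s)) (T f') t :=
  ((T.restrictScalars ℝ).toContinuousLinearMap.hasFDerivAt (x := f t)).comp_hasDerivAt t hf

theorem eq_of_hasDerivAt_linearMap (T : Matrix m n ℂ →ₗ[ℂ] Matrix m n ℂ) {f g : ℝ → Matrix m n ℂ}
    (hf : ∀ t, HasDerivAt f (T (f t)) t) (hg : ∀ t, HasDerivAt g (T (g t)) t) (h : f 0 = g 0) :
    f = g := by
  exact eq_of_hasDerivAt_linear (T.restrictScalars ℝ) hf hg h

end Norm

end Calculus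

/-- Hermitian matrices that are similar are unitarily similar. -/
theorem IsHermitian.exists_unitary_of_mul_eq_mul {m : Type*} [Fintype m] [DecidableEq m]
    {A B T : Matrix m m ℂ} (hA : A.IsHermitian) (hB : B.IsHermitian) (hT : IsUnit T)
    (h : A * T = T * B) : ∃ U ∈ unitaryGroup m ℂ, A = U * B * Uᴴ := by
  -- Equal characteristic polynomials give equal ordered eigenvalues, so both matrices diagonalize
  -- to the same matrix and the unitary is the quotient of the two eigenbases.
  have hc : A.charpoly = B.charpoly := by
    have hT' : IsUnit T.det := (isUnit_iff_isUnit_det T).1 hT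
    have : A = T * B * T⁻¹ := by rw [← h, mul_nonsing_inv_cancel_right _ _ hT']
    rw [this, charpoly_mul_comm, nonsing_inv_mul_cancel_left _ _ hT']
  have he := (hA.eigenvalues_eq_eigenvalues_iff hB).2 hc
  refine ⟨_, (hA.eigenvectorUnitary * star hB.eigenvectorUnitary).2, ?_⟩
  have h1 := hA.spectral_theorem
  have h2 := hB.conjStarAlgAut_star_eigenvectorUnitary
  rw [he, ← h2, Unitary.conjStarAlgAut_apply, Unitary.conjStarAlgAut_star_apply] at h1
  refine h1.trans ?_
  simp [star_eq_conjTranspose, mul_assoc]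

end Matrix

/-! ### Lyapunov equations with controllable right-hand side -/

section Lyapunov

open Matrix

variable {n p : ℕ} {α X S N D : Matrix (Fin n) (Fin n) ℂ} {ϑ : Matrix (Fin n) (Fin p) ℂ}

/-- Dual form of controllability: such a vector is orthogonal to every image $\alpha^\nu\vartheta
x$, and these span the space. -/
theorem Controllable.eq_zero_of_forall_pow (h : Controllable α ϑ) {v : Fin n → ℂ}
    (hv : ∀ k, ϑᴴ *ᵥ ((αᴴ ^ k) *ᵥ v) = 0) : v = 0 := by
  have key : (⊤ : Submodule ℂ (Fin n → ℂ)) ≤ LinearMap.ker (dotProductBilin ℂ ℂ (star v)) := by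
    rw [← h]
    refine iSup_le fun k => ?_
    rintro _ ⟨x, rfl⟩
    have hk : (α ^ (k : ℕ) * ϑ)ᴴ *ᵥ v = 0 := by
      rw [conjTranspose_mul, conjTranspose_pow, ← mulVec_mulVec, hv]
    rw [LinearMap.mem_ker, mulVecLin_apply]
    change star v ⬝ᵥ (α ^ (k : ℕ) * ϑ) *ᵥ x = 0
    rw [dotProduct_mulVec, ← conjTranspose_conjTranspose (α ^ (k : ℕ) * ϑ), ← star_mulVec, hk]
    simp
  exact dotProduct_star_self_eq_zero.1 (key (Submodule.mem_top (x := v)))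

theorem Controllable.mul_of_commute (h : Controllable α ϑ) {B : Matrix (Fin n) (Fin n) ℂ}
    (hB : IsUnit B) (hc : Commute α B) : Controllable α (B * ϑ) := by
  have h1 : ∀ k : ℕ, LinearMap.range (α ^ k * (B * ϑ)).mulVecLin =
      (LinearMap.range (α ^ k * ϑ).mulVecLin).map B.mulVecLin := by
    intro k
    rw [← Matrix.mul_assoc, (hc.pow_left k).eq, Matrix.mul_assoc, mulVecLin_mul,
      LinearMap.range_comp]
  unfold Controllable at *
  simp only [h1]
  rw [← Submodule.map_iSup, h, Submodule.map_top, LinearMap.range_eq_top]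
  exact mulVec_surjective_iff_isUnit.2 hB

open scoped MatrixOrder in
theorem Matrix.PosDef.exists_isUnit_eq_conjTranspose_mul_self (hS : S.PosDef) :
    ∃ B : Matrix (Fin n) (Fin n) ℂ, IsUnit B ∧ S = Bᴴ * B := by
  obtain ⟨B, hB⟩ := CStarAlgebra.nonneg_iff_eq_star_mul_self.1 hS.posSemidef.nonneg
  refine ⟨B, ?_, hB⟩
  have := hS.isUnit
  rw [hB] at this
  exact isUnit_of_mul_isUnit_right this

theorem mulVec_eq_zero_of_lyapunov_form_eq_zero (hD : D.PosSemidef) {v : Fin n → ℂ}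
    (h : star v ⬝ᵥ (ϑ * ϑᴴ + D) *ᵥ v = 0) : ϑᴴ *ᵥ v = 0 ∧ (ϑ * ϑᴴ + D) *ᵥ v = 0 := by
  have h1 := posSemidef_self_mul_conjTranspose ϑ
  have h2 := (h1.add hD).dotProduct_mulVec_zero_iff v |>.1 h
  rw [add_mulVec, dotProduct_add] at h
  have h3 := (add_eq_zero_iff_of_nonneg (h1.dotProduct_mulVec_nonneg v)
    (hD.dotProduct_mulVec_nonneg v)).1 h
  have h4 := (h1.dotProduct_mulVec_zero_iff v).1 h3.1
  refine ⟨?_, h2⟩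
  rwa [self_mul_conjTranspose_mulVec_eq_zero] at h4

/-- On $\ker X$ the quadratic form of the left-hand side vanishes, hence so does that of the
semidefinite right-hand side. Thus $\ker X$ is $\alpha^*$-invariant and lies in $\ker\vartheta^*$,
which controllability forbids unless it is trivial. -/
theorem eq_zero_of_mulVec_eq_zero_of_lyapunov (hc : Controllable α ϑ) (hD : D.PosSemidef)
    (hX : X.IsHermitian) (h : α * X - X * αᴴ = Complex.I • (ϑ * ϑᴴ + D)) {v : Fin n → ℂ}
    (hv : X *ᵥ v = 0) : v = 0 := by
  have step : ∀ w, X *ᵥ w = 0 → ϑᴴ *ᵥ w = 0 ∧ X *ᵥ (αᴴ *ᵥ w) = 0 := by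
    intro w hw
    have e : (α * X - X * αᴴ) *ᵥ w = - (X *ᵥ (αᴴ *ᵥ w)) := by
      rw [sub_mulVec, ← mulVec_mulVec, ← mulVec_mulVec, hw, mulVec_zero, zero_sub]
    have e0 : star w ⬝ᵥ X *ᵥ (αᴴ *ᵥ w) = 0 := by
      rw [dotProduct_mulVec, ← hX.eq, ← star_mulVec, hw]
      simp
    rw [h, smul_mulVec] at e
    have e1 := congrArg (fun x => star w ⬝ᵥ x) e
    simp only [dotProduct_smul, dotProduct_neg, e0, neg_zero, smul_eq_mul, mul_eq_zero,
      Complex.I_ne_zero, false_or] at e1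
    obtain ⟨h1, h2⟩ := mulVec_eq_zero_of_lyapunov_form_eq_zero hD e1
    refine ⟨h1, ?_⟩
    rw [h2, smul_zero] at e
    simpa using e.symm
  have all : ∀ k, X *ᵥ ((αᴴ ^ k) *ᵥ v) = 0 := by
    intro k
    induction k with
    | zero => simpa using hv
    | succ k ih =>
      rw [pow_succ', ← mulVec_mulVec]
      exact (step _ ih).2
  exact hc.eq_zero_of_forall_pow fun k => (step _ (all k)).1

/-- A Hermitian solution of a Lyapunov equation with controllable right-hand side is positive
definite, as soon as some Lyapunov equation for the same `α` has a positive definite solution. -/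
theorem posDef_of_lyapunov (hS : S.PosDef) (hN : N.PosSemidef)
    (hSN : α * S - S * αᴴ = Complex.I • N) (hc : Controllable α ϑ) (hD : D.PosSemidef)
    (hX : X.IsHermitian) (h : α * X - X * αᴴ = Complex.I • (ϑ * ϑᴴ + D)) : X.PosDef := by
  obtain ⟨B, hB, rfl⟩ := hS.exists_isUnit_eq_conjTranspose_mul_self
  have hBd : IsUnit B.det := (isUnit_iff_isUnit_det B).1 hB
  have hM : (B⁻¹ᴴ * X * B⁻¹).IsHermitian := isHermitian_conjTranspose_mul_mul _ hX
  have hpos : (B⁻¹ᴴ * X * B⁻¹).PosDef := by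
    rw [hM.posDef_iff_eigenvalues_pos]
    intro i
    -- The eigenvalues of $B^{-*}XB^{-1}$ are those of $X$ relative to $S=B^*B$. If one of them is
    -- $\mu\le0$, then $X-\mu S$ is singular, yet it solves a Lyapunov equation with right-hand side
    -- $\vartheta\vartheta^*+(D-\mu N)$, where $D-\mu N\ge0$.
    by_contra! hi
    have hv := hM.mulVec_eigenvectorBasis i
    set μ := hM.eigenvalues i
    set w : Fin n → ℂ := ⇑(hM.eigenvectorBasis i) with hw
    have hw0 : w ≠ 0 := (WithLp.ofLp_eq_zero 2).ne.2 <| hM.eigenvectorBasis.orthonormal.ne_zero i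
    have hY : α * (X + (-μ : ℂ) • (Bᴴ * B)) - (X + (-μ : ℂ) • (Bᴴ * B)) * αᴴ =
        Complex.I • (ϑ * ϑᴴ + (D + (-μ : ℂ) • N)) := by
      rw [← add_assoc, smul_add, ← h, smul_comm, ← hSN]
      simp only [mul_add, add_mul, Matrix.mul_smul, Matrix.smul_mul, smul_sub]
      abel
    have hμ : (0 : ℂ) ≤ -μ := by
      rw [← Complex.ofReal_neg]
      exact Complex.zero_le_real.2 (by linarith)
    have hYH : (X + (-μ : ℂ) • (Bᴴ * B)).IsHermitian := by
      refine hX.add ?_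
      rw [IsHermitian, conjTranspose_smul, hS.isHermitian.eq]
      simp
    have hker : (X + (-μ : ℂ) • (Bᴴ * B)) *ᵥ (B⁻¹ *ᵥ w) = 0 := by
      have e1 : X *ᵥ (B⁻¹ *ᵥ w) = Bᴴ *ᵥ ((B⁻¹ᴴ * X * B⁻¹) *ᵥ w) := by
        rw [mulVec_mulVec, mulVec_mulVec, ← Matrix.mul_assoc, ← Matrix.mul_assoc,
          ← conjTranspose_mul, nonsing_inv_mul _ hBd, conjTranspose_one, Matrix.one_mul]
      have e2 : (Bᴴ * B) *ᵥ (B⁻¹ *ᵥ w) = Bᴴ *ᵥ w := by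
        rw [mulVec_mulVec, Matrix.mul_assoc, mul_nonsing_inv _ hBd, Matrix.mul_one]
      rw [add_mulVec, smul_mulVec, e1, e2, hv, mulVec_smul]
      ext a
      simp
    have h0 := eq_zero_of_mulVec_eq_zero_of_lyapunov hc (hD.add (hN.smul hμ)) hYH hY hker
    apply hw0
    have := congrArg (fun x => B *ᵥ x) h0
    simpa [mulVec_mulVec, mul_nonsing_inv _ hBd] using this
  have := hpos.conjTranspose_mul_mul_same (B := B) (mulVec_injective_iff_isUnit.2 hB)
  have e : Bᴴ * (B⁻¹ᴴ * X * B⁻¹) * B = X := by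
    rw [← Matrix.mul_assoc, ← Matrix.mul_assoc, ← conjTranspose_mul, nonsing_inv_mul _ hBd,
      conjTranspose_one, Matrix.one_mul, Matrix.mul_assoc, nonsing_inv_mul _ hBd, Matrix.mul_one]
  rwa [e] at this

/-- The Lyapunov operator `X ↦ α X - X α*`. -/
def lyapunov (α : Matrix (Fin n) (Fin n) ℂ) :
    Matrix (Fin n) (Fin n) ℂ →ₗ[ℂ] Matrix (Fin n) (Fin n) ℂ :=
  LinearMap.mulLeft ℂ α - LinearMap.mulRight ℂ αᴴ

@[simp]
theorem lyapunov_apply (α X : Matrix (Fin n) (Fin n) ℂ) : lyapunov α X = α * X - X * αᴴ := rfl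

/-- Adding a real multiple of $X$ to $S$ does not change the Lyapunov equation, so $S+cX>0$ for
every real $c$; this is impossible when $X$ has a nonzero eigenvalue. -/
theorem Matrix.IsHermitian.eq_zero_of_lyapunov_eq_zero (hS : S.PosDef) (hD : D.PosSemidef)
    (hc : Controllable α ϑ) (hSN : α * S - S * αᴴ = Complex.I • (ϑ * ϑᴴ + D))
    (hX : X.IsHermitian) (h : α * X - X * αᴴ = 0) : X = 0 := by
  by_contra hne
  obtain ⟨v, r, hr, hv, hXv⟩ := hX.exists_eigenvector_of_ne_zero hne
  have hv2 : 0 < star v ⬝ᵥ v := dotProduct_star_self_pos_iff.2 hv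
  have hSv := hS.dotProduct_mulVec_pos hv
  obtain ⟨a, ha⟩ : ∃ a : ℝ, (a : ℂ) = star v ⬝ᵥ S *ᵥ v :=
    ⟨_, (Complex.eq_re_of_ofReal_le (r := 0) (by simpa using hSv.le)).symm⟩
  obtain ⟨b, hb⟩ : ∃ b : ℝ, (b : ℂ) = star v ⬝ᵥ v :=
    ⟨_, (Complex.eq_re_of_ofReal_le (r := 0) (by simp)).symm⟩
  have hb0 : (b : ℂ) ≠ 0 := hb ▸ hv2.ne'
  have hr0 : (r : ℂ) ≠ 0 := by exact_mod_cast hr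
  -- The coefficient is chosen to make the quadratic form of $S+cX$ vanish at the eigenvector $v$.
  have hP := posDef_of_lyapunov (X := S + ((-a / (r * b) : ℝ) : ℂ) • X) hS
    ((posSemidef_self_mul_conjTranspose ϑ).add hD) hSN hc hD
    (hS.isHermitian.add (by rw [IsHermitian, conjTranspose_smul, hX.eq]; simp))
    (by
      rw [← hSN, mul_add, add_mul, Matrix.mul_smul, Matrix.smul_mul, add_sub_add_comm,
        ← smul_sub, h, smul_zero, add_zero])
  have := hP.dotProduct_mulVec_pos hv
  rw [add_mulVec, smul_mulVec, dotProduct_add, dotProduct_smul, hXv, ← ha] at this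
  refine this.ne' ?_
  have e : star v ⬝ᵥ r • v = (r : ℂ) * b := by rw [hb, dotProduct_smul]; simp
  rw [e]
  push_cast
  simp only [smul_eq_mul]
  field_simp
  ring

theorem lyapunov_injective (hS : S.PosDef) (hD : D.PosSemidef)
    (hc : Controllable α ϑ) (hSN : α * S - S * αᴴ = Complex.I • (ϑ * ϑᴴ + D)) :
    Function.Injective (lyapunov α) := by
  rw [injective_iff_map_eq_zero]
  intro X h
  rw [lyapunov_apply] at h
  have h' : α * Xᴴ - Xᴴ * αᴴ = 0 := by
    have := congrArg conjTranspose h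
    simp only [conjTranspose_sub, conjTranspose_mul, conjTranspose_conjTranspose,
      conjTranspose_zero] at this
    rw [← neg_sub, this, neg_zero]
  -- The kernel is closed under adjoints, so it suffices to treat the Hermitian matrices $X+X^*$ and
  -- $i(X-X^*)$.
  have h1 := IsHermitian.eq_zero_of_lyapunov_eq_zero hS hD hc hSN
    (X := X + Xᴴ) (by simp [IsHermitian, add_comm])
    (by rw [mul_add, add_mul, add_sub_add_comm, h, h', add_zero])
  have h2 := IsHermitian.eq_zero_of_lyapunov_eq_zero hS hD hc hSN
    (X := Complex.I • (X - Xᴴ)) (by simp [IsHermitian, ← smul_neg])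
    (by rw [Matrix.mul_smul, Matrix.smul_mul, ← smul_sub, mul_sub, sub_mul, sub_sub_sub_comm,
      h, h', sub_zero, smul_zero])
  have h3 : X = Xᴴ := sub_eq_zero.1 ((smul_eq_zero_iff_right Complex.I_ne_zero).1 h2)
  rw [← h3, ← two_smul ℂ, smul_eq_zero_iff_right two_ne_zero] at h1
  exact h1

/-- For $\alpha^*v=\bar zv$ the Lyapunov equation gives $2\operatorname{Im}z\cdot
v^*Sv=v^*(\vartheta\vartheta^*+D)v\ge0$. If $\operatorname{Im}z\le0$, then $\vartheta^*v=0$, and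
controllability forces $v=0$. -/
theorem notMem_spectrum_of_im_nonpos (hS : S.PosDef) (hD : D.PosSemidef)
    (hc : Controllable α ϑ) (hSN : α * S - S * αᴴ = Complex.I • (ϑ * ϑᴴ + D)) {z : ℂ}
    (hz : z.im ≤ 0) : z ∉ spectrum ℂ α := by
  rw [spectrum.notMem_iff, Algebra.algebraMap_eq_smul_one, ← isUnit_conjTranspose,
    ← mulVec_injective_iff_isUnit]
  refine (injective_iff_map_eq_zero ((z • 1 - α)ᴴ.mulVecLin)).2 fun v hv => ?_
  rw [mulVecLin_apply] at hv
  have hv' : αᴴ *ᵥ v = star z • v := by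
    rw [conjTranspose_sub, conjTranspose_smul, conjTranspose_one, sub_mulVec, smul_mulVec,
      one_mulVec, sub_eq_zero] at hv
    exact hv.symm
  have hq : star v ⬝ᵥ (α * S - S * αᴴ) *ᵥ v = (z - star z) * (star v ⬝ᵥ S *ᵥ v) := by
    have : star v ᵥ* α = z • star v := by
      rw [← conjTranspose_conjTranspose α, ← star_mulVec, hv']
      simp
    rw [sub_mulVec, dotProduct_sub, ← mulVec_mulVec, ← mulVec_mulVec, hv', dotProduct_mulVec,
      this, mulVec_smul, dotProduct_smul, smul_dotProduct, smul_eq_mul, smul_eq_mul, sub_mul]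
  have hP := (posSemidef_self_mul_conjTranspose ϑ).add hD
  have hN := hP.dotProduct_mulVec_nonneg v
  have hS0 := hS.posSemidef.dotProduct_mulVec_nonneg v
  have hN0 : star v ⬝ᵥ (ϑ * ϑᴴ + D) *ᵥ v = 0 := by
    rw [hSN, smul_mulVec, dotProduct_smul, smul_eq_mul] at hq
    rw [Complex.le_def] at hN hS0
    obtain ⟨hN1, hN2⟩ := hN
    obtain ⟨hS1, hS2⟩ := hS0
    have := congrArg Complex.im hq
    simp only [Complex.mul_im, Complex.I_re, Complex.I_im, Complex.sub_re, Complex.sub_im,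
      Complex.star_def, Complex.conj_re, Complex.conj_im, Complex.zero_re, Complex.zero_im]
      at this hN1 hN2 hS1 hS2
    apply Complex.ext
    · simp only [Complex.zero_re]
      nlinarith
    · exact hN2.symm
  have h1 := (mulVec_eq_zero_of_lyapunov_form_eq_zero hD hN0).1
  refine hc.eq_zero_of_forall_pow fun k => ?_
  have : (αᴴ ^ k) *ᵥ v = (star z) ^ k • v := by
    induction k with
    | zero => simp
    | succ k ih => rw [pow_succ, ← mulVec_mulVec, hv', mulVec_smul, ih, smul_smul, pow_succ']
  rw [this, mulVec_smul, h1, smul_zero]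

end Lyapunov

/-! ### Algebra of the signature matrix -/

section Signature

open Matrix

variable (m₁ m₂ : ℕ)

@[simp]
theorem sgn_mul_sgn : sgn m₁ m₂ * sgn m₁ m₂ = 1 := by
  simp [sgn, fromBlocks_multiply]

@[simp]
theorem conjTranspose_sgn : (sgn m₁ m₂)ᴴ = sgn m₁ m₂ := by
  simp [sgn, fromBlocks_conjTranspose]

theorem one_add_sgn_mul_one_sub_sgn : (1 + sgn m₁ m₂) * (1 - sgn m₁ m₂) = 0 := by
  rw [add_mul, mul_sub, mul_sub, sgn_mul_sgn]
  simp

theorem one_sub_sgn_mul_one_add_sgn : (1 - sgn m₁ m₂) * (1 + sgn m₁ m₂) = 0 := by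
  rw [sub_mul, mul_add, mul_add, sgn_mul_sgn]
  simp [add_comm]

end Signature

/-! ### The discrete evolution and transfer functions -/

namespace Quadruple

open Matrix Complex

variable {n m₁ m₂ : ℕ} {Q : Quadruple n m₁ m₂}

theorem lam_mul_conjTranspose_lam (Q : Quadruple n m₁ m₂) :
    Q.Lam * Q.Lamᴴ = Q.ϑ₁ * Q.ϑ₁ᴴ + Q.ϑ₂ * Q.ϑ₂ᴴ := by
  rw [Lam, conjTranspose_fromCols_eq_fromRows_conjTranspose, fromCols_mul_fromRows]

/-- The matrix identity behind the invariance of the Lyapunov equation under the discrete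
evolution. -/
theorem lyapunov_next (ha : IsUnit Q.α)
    (h : Q.α * Q.S - Q.S * Q.αᴴ = I • (Q.Lam * Q.Lamᴴ)) :
    Q.α * Q.next.S - Q.next.S * Q.αᴴ = I • (Q.next.Lam * Q.next.Lamᴴ) := by
  have had : IsUnit Q.α.det := (isUnit_iff_isUnit_det _).1 ha
  have h1 : Q.α * Q.α⁻¹ = 1 := mul_nonsing_inv _ had
  have h2 : (Q.α⁻¹)ᴴ * Q.αᴴ = 1 := by rw [← conjTranspose_mul, h1, conjTranspose_one]
  have h3 : Q.α⁻¹ * Q.α = 1 := nonsing_inv_mul _ had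
  have h4 : Q.αᴴ * (Q.α⁻¹)ᴴ = 1 := by rw [← conjTranspose_mul, h3, conjTranspose_one]
  rw [lam_next]
  simp only [next]
  generalize (Q.α⁻¹) = B at *
  set A := Q.α
  set S := Q.S
  set L := Q.Lam
  -- The Lyapunov equation multiplied by $\alpha^{-1}$ on the left and by its adjoint on the right.
  have h5 : I • (B * (L * (Lᴴ * Bᴴ))) = S * Bᴴ - B * S := by
    have : B * (I • (L * Lᴴ)) * Bᴴ = S * Bᴴ - B * S := by
      rw [← h, mul_sub, sub_mul, ← Matrix.mul_assoc, h3, one_mul, Matrix.mul_assoc B,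
        Matrix.mul_assoc S, h4, mul_one]
    simpa [Matrix.mul_assoc] using this
  have c1 : ∀ {l : ℕ} (x : Matrix (Fin n) (Fin l) ℂ), A * (B * x) = x := by
    intro l x; rw [← Matrix.mul_assoc, h1, Matrix.one_mul]
  simp only [Matrix.mul_add, Matrix.add_mul, Matrix.mul_smul, Matrix.smul_mul, smul_smul,
    Matrix.mul_assoc, conjTranspose_add, conjTranspose_smul, conjTranspose_mul,
    conjTranspose_sgn, smul_add, c1, h2, Matrix.mul_one, ← Matrix.mul_assoc (sgn m₁ m₂) (sgn m₁ m₂),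
    sgn_mul_sgn, Matrix.one_mul, Complex.star_def, conj_I, mul_neg, I_mul_I, neg_neg]
  have h6 : I * (-I * I) = I := by simp
  rw [h6, h5, ← h]
  module

theorem StronglyAdmissible.lyapunov_eq (h : Q.StronglyAdmissible) :
    Q.α * Q.S - Q.S * Q.αᴴ = I • (Q.Lam * Q.Lamᴴ) := by
  rw [lam_mul_conjTranspose_lam]
  exact h.1.2

theorem stronglyAdmissible_iff :
    Q.StronglyAdmissible ↔ Q.S.PosDef ∧
      Q.α * Q.S - Q.S * Q.αᴴ = I • (Q.Lam * Q.Lamᴴ) ∧ Controllable Q.α Q.ϑ₁ := by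
  rw [lam_mul_conjTranspose_lam, StronglyAdmissible, Admissible, and_assoc]

theorem StronglyAdmissible.notMem_spectrum (h : Q.StronglyAdmissible) {z : ℂ} (hz : z.im ≤ 0) :
    z ∉ spectrum ℂ Q.α :=
  notMem_spectrum_of_im_nonpos h.1.1 (posSemidef_self_mul_conjTranspose Q.ϑ₂) h.2 h.1.2 hz

theorem StronglyAdmissible.isUnit_alpha (h : Q.StronglyAdmissible) : IsUnit Q.α := by
  have := h.notMem_spectrum (z := 0) (by simp)
  rwa [spectrum.zero_notMem_iff] at this

theorem isUnit_sub_of_notMem_spectrum {A : Matrix (Fin n) (Fin n) ℂ} {z : ℂ}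
    (h : z ∉ spectrum ℂ A) : IsUnit (z • 1 - A) := by
  rwa [spectrum.notMem_iff, Algebra.algebraMap_eq_smul_one] at h

theorem isHermitian_next_S (h : Q.S.IsHermitian) : Q.next.S.IsHermitian := by
  simp [IsHermitian, next, Matrix.mul_assoc, h.eq]

/-- Controllability survives because $I+i\alpha^{-1}=(\alpha+iI)\alpha^{-1}$ is invertible and
commutes with $\alpha$; positivity then follows from the Lyapunov equation. -/
theorem StronglyAdmissible.next (h : Q.StronglyAdmissible) : Q.next.StronglyAdmissible := by
  have ha := h.isUnit_alpha
  have had : IsUnit Q.α.det := (isUnit_iff_isUnit_det _).1 ha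
  have hL := lyapunov_next ha h.lyapunov_eq
  have hc : Controllable Q.α Q.next.ϑ₁ := by
    refine h.2.mul_of_commute ?_ ?_
    · have h1 := isUnit_sub_of_notMem_spectrum (h.notMem_spectrum (z := -I) (by simp))
      have e : 1 + I • Q.α⁻¹ = -((-I) • 1 - Q.α) * Q.α⁻¹ := by
        rw [neg_sub, sub_mul, mul_nonsing_inv _ had]
        simp
      rw [e]
      exact h1.neg.mul ((isUnit_nonsing_inv_iff).2 ha)
    · refine (Commute.one_right _).add_right (Commute.smul_right ?_ _)
      rw [Commute, SemiconjBy, mul_nonsing_inv _ had, nonsing_inv_mul _ had]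
  refine stronglyAdmissible_iff.2 ⟨?_, hL, hc⟩
  rw [lam_mul_conjTranspose_lam] at hL
  exact posDef_of_lyapunov h.1.1 ((posSemidef_self_mul_conjTranspose Q.ϑ₁).add
    (posSemidef_self_mul_conjTranspose Q.ϑ₂)) h.1.2 hc
    (posSemidef_self_mul_conjTranspose Q.next.ϑ₂) (isHermitian_next_S h.1.1.isHermitian) hL

theorem seq_alpha (Q : Quadruple n m₁ m₂) (k : ℕ) : (Q.seq k).α = Q.α := by
  induction k with
  | zero => rfl
  | succ k ih => exact ih

theorem StronglyAdmissible.seq (h : Q.StronglyAdmissible) (k : ℕ) :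
    (Q.seq k).StronglyAdmissible := by
  induction k with
  | zero => exact h
  | succ k ih => exact ih.next

/-- Sandwiching the Lyapunov equation between the resolvents $R$ at $z$ and $R'^*$, with $R'$ at
$\bar z$, gives $iR\Lambda\Lambda^*R'^*=RS-SR'^*$, which cancels the linear terms of the product
against the quadratic one. -/
theorem transfer_mul_conjTranspose_transfer (hS : Q.S.PosDef)
    (h : Q.α * Q.S - Q.S * Q.αᴴ = I • (Q.Lam * Q.Lamᴴ)) {z : ℂ}
    (hz : z ∉ spectrum ℂ Q.α) (hz' : star z ∉ spectrum ℂ Q.α) :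
    Q.transfer z * (Q.transfer (star z))ᴴ = 1 := by
  have hSd : IsUnit Q.S.det := (isUnit_iff_isUnit_det _).1 hS.isUnit
  have hR : IsUnit (z • 1 - Q.α).det :=
    (isUnit_iff_isUnit_det _).1 (isUnit_sub_of_notMem_spectrum hz)
  have hR' : IsUnit (star z • 1 - Q.α).det :=
    (isUnit_iff_isUnit_det _).1 (isUnit_sub_of_notMem_spectrum hz')
  have r1 : (z • 1 - Q.α)⁻¹ * (z • 1 - Q.α) = 1 := nonsing_inv_mul _ hR
  have r2 : (z • 1 - Q.αᴴ) * ((star z • 1 - Q.α)⁻¹)ᴴ = 1 := by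
    have := congrArg conjTranspose (nonsing_inv_mul _ hR')
    simpa only [conjTranspose_mul, conjTranspose_sub, conjTranspose_smul, conjTranspose_one,
      star_star] using this
  have hT : (Q.S⁻¹)ᴴ = Q.S⁻¹ := hS.inv.isHermitian.eq
  have s1 : Q.S⁻¹ * Q.S = 1 := nonsing_inv_mul _ hSd
  have s2 : Q.S * Q.S⁻¹ = 1 := mul_nonsing_inv _ hSd
  simp only [transfer]
  generalize (z • 1 - Q.α)⁻¹ = R at *
  generalize (star z • 1 - Q.α)⁻¹ = R' at *
  generalize Q.S⁻¹ = T at *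
  set A := Q.α
  set S := Q.S
  set L := Q.Lam
  have key : I • (R * (L * (Lᴴ * R'ᴴ))) = R * S - S * R'ᴴ := by
    have e : S * (z • 1 - Aᴴ) - (z • 1 - A) * S = I • (L * Lᴴ) := by
      rw [← h]
      simp [mul_sub, sub_mul]
    have : R * (I • (L * Lᴴ)) * R'ᴴ = R * S - S * R'ᴴ := by
      rw [← e, mul_sub, sub_mul, ← Matrix.mul_assoc R (_ - _), r1, one_mul, ← Matrix.mul_assoc R S,
        Matrix.mul_assoc (R * S), r2, mul_one]
    simpa [Matrix.mul_assoc] using this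
  have key2 : Lᴴ * (T * (R * (L * (Lᴴ * (R'ᴴ * (T * L)))))) =
      (-I) • (Lᴴ * (T * (R * L))) + I • (Lᴴ * (R'ᴴ * (T * L))) := by
    have := congrArg (fun x => (-I) • (Lᴴ * T * x * (T * L))) key
    simp only [Matrix.mul_smul, Matrix.smul_mul, smul_smul, neg_mul, I_mul_I, neg_neg, one_smul,
      Matrix.mul_sub, Matrix.sub_mul, Matrix.mul_assoc] at this
    rw [this, ← Matrix.mul_assoc S T, s2, Matrix.one_mul, ← Matrix.mul_assoc T S, s1,
      Matrix.one_mul]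
    module
  simp only [Matrix.mul_add, Matrix.add_mul, Matrix.mul_smul, Matrix.smul_mul,
    Matrix.mul_assoc, conjTranspose_add, conjTranspose_smul, conjTranspose_mul,
    conjTranspose_one, conjTranspose_conjTranspose,
    Matrix.mul_one, Matrix.one_mul, Complex.star_def, conj_I, hT]
  rw [key2]
  simp only [smul_add, smul_smul, mul_neg, neg_mul, I_mul_I, neg_neg, one_smul]
  module

theorem next_S_mul_conjTranspose_alpha (ha : IsUnit Q.α)
    (h : Q.α * Q.S - Q.S * Q.αᴴ = I • (Q.Lam * Q.Lamᴴ)) :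
    Q.next.S * Q.αᴴ = Q.α * Q.S + Q.α⁻¹ * Q.S - I • (Q.next.Lam * Q.Lamᴴ) := by
  have had : IsUnit Q.α.det := (isUnit_iff_isUnit_det _).1 ha
  have h2 : (Q.α⁻¹)ᴴ * Q.αᴴ = 1 := by
    rw [← conjTranspose_mul, mul_nonsing_inv _ had, conjTranspose_one]
  rw [lam_next]
  rw [sub_eq_iff_eq_add] at h
  rw [h]
  simp only [Quadruple.next, Matrix.add_mul, Matrix.mul_assoc, h2, Matrix.mul_one, smul_add,
    Matrix.smul_mul, smul_smul, I_mul_I]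
  module

theorem potential_zero (Q : Quadruple n m₁ m₂) :
    Q.potential 0 = sgn m₁ m₂ + Q.Lamᴴ * Q.S⁻¹ * Q.Lam -
      Q.next.Lamᴴ * Q.next.S⁻¹ * Q.next.Lam := rfl

/-- This is where $C$ enters: `next_S_mul_conjTranspose_alpha` multiplied by
$\Lambda_{k+1}^*S_{k+1}^{-1}$ produces exactly the combination defining the potential. -/
theorem next_lam_mul_inv_S_mul (ha : IsUnit Q.α) (hS : Q.S.PosDef) (hS' : Q.next.S.PosDef)
    (h : Q.α * Q.S - Q.S * Q.αᴴ = I • (Q.Lam * Q.Lamᴴ)) :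
    Q.next.Lamᴴ * Q.next.S⁻¹ * (Q.α + Q.α⁻¹) =
      Q.Lamᴴ * Q.S⁻¹ * Q.α - I • (Q.potential 0 * (Q.Lamᴴ * Q.S⁻¹)) := by
  have had : IsUnit Q.α.det := (isUnit_iff_isUnit_det _).1 ha
  have hSd : IsUnit Q.S.det := (isUnit_iff_isUnit_det _).1 hS.isUnit
  have hSd' : IsUnit Q.next.S.det := (isUnit_iff_isUnit_det _).1 hS'.isUnit
  have h2 : (Q.α⁻¹)ᴴ * Q.αᴴ = 1 := by
    rw [← conjTranspose_mul, mul_nonsing_inv _ had, conjTranspose_one]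
  have hl : Q.next.Lamᴴ * Q.αᴴ = Q.Lamᴴ * Q.αᴴ - I • (sgn m₁ m₂ * Q.Lamᴴ) := by
    rw [lam_next]
    simp only [conjTranspose_add, conjTranspose_smul, conjTranspose_mul, conjTranspose_sgn,
      Complex.star_def, conj_I, Matrix.add_mul, Matrix.smul_mul, Matrix.mul_assoc, h2,
      Matrix.mul_one]
    module
  have hs := congrArg (fun x => Q.next.Lamᴴ * (Q.next.S⁻¹ * x))
    (next_S_mul_conjTranspose_alpha ha h)
  simp only [nonsing_inv_mul_cancel_left _ _ hSd', hl] at hs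
  have s1 : Q.S⁻¹ * Q.S = 1 := nonsing_inv_mul _ hSd
  have has : Q.α * Q.S = Q.S * Q.αᴴ + I • (Q.Lam * Q.Lamᴴ) := by rw [← h]; abel
  suffices hh : Q.next.Lamᴴ * Q.next.S⁻¹ * (Q.α + Q.α⁻¹) * Q.S =
      (Q.Lamᴴ * Q.S⁻¹ * Q.α - I • (Q.potential 0 * (Q.Lamᴴ * Q.S⁻¹))) * Q.S by
    have := congrArg (fun x => x * Q.S⁻¹) hh
    simpa only [mul_nonsing_inv_cancel_right _ _ hSd] using this
  rw [potential_zero]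
  simp only [Matrix.add_mul, Matrix.sub_mul, Matrix.mul_add, Matrix.mul_sub, Matrix.mul_assoc,
    Matrix.smul_mul, Matrix.mul_smul, s1, Matrix.mul_one] at hs ⊢
  have hx : Q.Lamᴴ * (Q.S⁻¹ * (Q.α * Q.S)) =
      Q.Lamᴴ * Q.αᴴ + I • (Q.Lamᴴ * (Q.S⁻¹ * (Q.Lam * Q.Lamᴴ))) := by
    rw [has, Matrix.mul_add, nonsing_inv_mul_cancel_left _ _ hSd, Matrix.mul_add, Matrix.mul_smul,
      Matrix.mul_smul]
  rw [hx]
  rw [eq_sub_iff_add_eq] at hs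
  rw [← hs]
  module

/-- The transfer functions intertwine the discrete systems with potentials `j` and `C`. -/
theorem next_transfer_mul (ha : IsUnit Q.α) (hS : Q.S.PosDef) (hS' : Q.next.S.PosDef)
    (h : Q.α * Q.S - Q.S * Q.αᴴ = I • (Q.Lam * Q.Lamᴴ)) {z : ℂ} (hz : z ∉ spectrum ℂ Q.α) :
    Q.next.transfer z * (z • 1 - I • sgn m₁ m₂) = (z • 1 - I • Q.potential 0) * Q.transfer z := by
  have key := next_lam_mul_inv_S_mul ha hS hS' h
  have had : IsUnit Q.α.det := (isUnit_iff_isUnit_det _).1 ha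
  have hR : IsUnit (z • 1 - Q.α).det :=
    (isUnit_iff_isUnit_det _).1 (isUnit_sub_of_notMem_spectrum hz)
  have r1 : (z • 1 - Q.α)⁻¹ * (z • 1 - Q.α) = 1 := nonsing_inv_mul _ hR
  have r2 : (z • 1 - Q.α) * (z • 1 - Q.α)⁻¹ = 1 := mul_nonsing_inv _ hR
  have a1 : Q.α * Q.α⁻¹ = 1 := mul_nonsing_inv _ had
  have a2 : Q.α⁻¹ * Q.α = 1 := nonsing_inv_mul _ had
  have hp := potential_zero Q
  -- In this splitting the first summand cancels the resolvent $R$; the second becomes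
  -- $\Lambda+(\alpha+\alpha^{-1})R\Lambda$ under $R$, which is where `key` applies.
  have hl : Q.next.Lam * (z • 1 - I • sgn m₁ m₂) =
      (z • 1 - Q.α) * (Q.next.Lam - Q.Lam) + (z • Q.Lam + Q.α⁻¹ * Q.Lam) := by
    rw [lam_next]
    simp only [Matrix.add_mul, Matrix.sub_mul, Matrix.mul_sub, Matrix.mul_smul,
      Matrix.smul_mul, Matrix.mul_one, Matrix.one_mul, Matrix.mul_assoc, sgn_mul_sgn,
      add_sub_cancel_left, mul_nonsing_inv_cancel_left _ _ had, smul_smul, I_mul_I, smul_sub,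
      smul_add]
    module
  have hn : Q.next.α = Q.α := rfl
  simp only [transfer, hn]
  generalize (z • 1 - Q.α)⁻¹ = R at *
  generalize hX' : Q.next.Lamᴴ * Q.next.S⁻¹ = X' at *
  generalize hX : Q.Lamᴴ * Q.S⁻¹ = X at *
  have hRA : z • R = 1 + Q.α * R := by
    rw [sub_mul, Matrix.smul_mul, one_mul] at r2
    rw [← r2]; abel
  have hRA' : z • R = 1 + R * Q.α := by
    rw [mul_sub, Matrix.mul_smul, mul_one] at r1
    rw [← r1]; abel
  have hcomm : R * (z • Q.Lam + Q.α⁻¹ * Q.Lam) = Q.Lam + (Q.α + Q.α⁻¹) * (R * Q.Lam) := by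
    have c1 : Q.α * R = R * Q.α := by
      have := hRA.symm.trans hRA'
      simpa using this
    have c2 : R * Q.α⁻¹ = Q.α⁻¹ * R := by
      have := congrArg (fun x => Q.α⁻¹ * x * Q.α⁻¹) c1
      simp only [Matrix.mul_assoc, a1, Matrix.mul_one] at this
      rwa [← Matrix.mul_assoc, a2, one_mul] at this
    rw [Matrix.mul_add, Matrix.mul_smul, ← Matrix.smul_mul, hRA, ← Matrix.mul_assoc R, c2]
    simp only [Matrix.add_mul, Matrix.one_mul, Matrix.mul_assoc, add_assoc]
  have e1 : X' * R * Q.next.Lam * (z • 1 - I • sgn m₁ m₂) =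
      X' * Q.next.Lam + (X * Q.α - I • (Q.potential 0 * X)) * (R * Q.Lam) := by
    rw [← key, Matrix.mul_assoc, hl, Matrix.mul_assoc, Matrix.mul_add R, ← Matrix.mul_assoc R, r1,
      Matrix.one_mul, hcomm, Matrix.mul_assoc, ← Matrix.mul_add]
    congr 1
    abel
  have e2 : z • (X * R * Q.Lam) = X * Q.Lam + X * Q.α * (R * Q.Lam) := by
    rw [Matrix.mul_assoc, ← Matrix.mul_smul, ← Matrix.smul_mul, hRA]
    simp only [Matrix.mul_add, Matrix.add_mul, Matrix.one_mul, Matrix.mul_assoc]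
  rw [add_mul, Matrix.one_mul, Matrix.smul_mul, e1, mul_add, mul_one, Matrix.mul_smul, sub_mul,
    Matrix.smul_mul, Matrix.one_mul, e2]
  rw [← sub_eq_zero]
  nth_rewrite 2 [hp]
  simp only [Matrix.sub_mul, Matrix.smul_mul, Matrix.mul_assoc, smul_add, smul_sub]
  module

end Quadruple

/-! ### Consequences at $z=\pm i$: annihilation relations and the signature of the potential -/

namespace Quadruple

open Matrix Complex

variable {n m₁ m₂ : ℕ} {Q : Quadruple n m₁ m₂}

theorem StronglyAdmissible.isHermitian_potential (h : Q.StronglyAdmissible) :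
    (Q.potential 0).IsHermitian := by
  rw [IsHermitian, potential_zero]
  simp only [conjTranspose_sub, conjTranspose_add, conjTranspose_mul, conjTranspose_sgn,
    conjTranspose_conjTranspose, h.1.1.inv.isHermitian.eq, h.next.1.1.inv.isHermitian.eq,
    Matrix.mul_assoc]

theorem StronglyAdmissible.neg_I_notMem (h : Q.StronglyAdmissible) : -I ∉ spectrum ℂ Q.α :=
  h.notMem_spectrum (by simp)

theorem StronglyAdmissible.transfer_I_mul (h : Q.StronglyAdmissible) (hi : I ∉ spectrum ℂ Q.α) :
    Q.transfer I * (Q.transfer (-I))ᴴ = 1 := by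
  have := transfer_mul_conjTranspose_transfer h.1.1 h.lyapunov_eq hi
    (by simpa using h.neg_I_notMem)
  simpa using this

theorem StronglyAdmissible.transfer_neg_I_mul (h : Q.StronglyAdmissible)
    (hi : I ∉ spectrum ℂ Q.α) : Q.transfer (-I) * (Q.transfer I)ᴴ = 1 := by
  have := congrArg conjTranspose (h.transfer_I_mul hi)
  simpa using this

/-- At $z=i$ the factors $z-ij$ and $z-iC$ are $i$ times $1-j$ and $1-C$; at $z=-i$ they give $1+j$
and $1+C$. -/
theorem StronglyAdmissible.next_transfer_I_mul (h : Q.StronglyAdmissible)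
    (hi : I ∉ spectrum ℂ Q.α) :
    Q.next.transfer I * (1 - sgn m₁ m₂) = (1 - Q.potential 0) * Q.transfer I := by
  have := next_transfer_mul h.isUnit_alpha h.1.1 h.next.1.1 h.lyapunov_eq hi
  rw [← smul_sub, ← smul_sub, Matrix.mul_smul, Matrix.smul_mul] at this
  exact smul_right_injective _ I_ne_zero this

theorem StronglyAdmissible.next_transfer_neg_I_mul (h : Q.StronglyAdmissible) :
    Q.next.transfer (-I) * (1 + sgn m₁ m₂) = (1 + Q.potential 0) * Q.transfer (-I) := by
  have := next_transfer_mul h.isUnit_alpha h.1.1 h.next.1.1 h.lyapunov_eq h.neg_I_notMem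
  have e : ∀ x : Matrix (Fin m₁ ⊕ Fin m₂) (Fin m₁ ⊕ Fin m₂) ℂ,
      (-I) • (1 : Matrix _ _ ℂ) - I • x = (-I) • (1 + x) := fun x => by module
  rw [e, e, Matrix.mul_smul, Matrix.smul_mul] at this
  exact smul_right_injective _ (neg_ne_zero.2 I_ne_zero) this

theorem StronglyAdmissible.one_sub_potential_mul_Hplus (h : Q.StronglyAdmissible)
    (hi : I ∉ spectrum ℂ Q.α) : (1 - Q.potential 0) * Q.Hplus = 0 := by
  rw [Hplus, ← Matrix.mul_assoc, ← Matrix.mul_assoc, ← h.next_transfer_I_mul hi,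
    Matrix.mul_assoc (Q.next.transfer I), one_sub_sgn_mul_one_add_sgn]
  simp

theorem StronglyAdmissible.one_add_potential_mul_Hminus (h : Q.StronglyAdmissible) :
    (1 + Q.potential 0) * Q.Hminus = 0 := by
  rw [Hminus, ← Matrix.mul_assoc, ← Matrix.mul_assoc, ← h.next_transfer_neg_I_mul,
    Matrix.mul_assoc (Q.next.transfer (-I)), one_add_sgn_mul_one_sub_sgn]
  simp

theorem StronglyAdmissible.one_sub_potential_eq (h : Q.StronglyAdmissible)
    (hi : I ∉ spectrum ℂ Q.α) :
    1 - Q.potential 0 = Q.next.transfer I * (1 - sgn m₁ m₂) * (Q.transfer (-I))ᴴ := by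
  rw [h.next_transfer_I_mul hi, Matrix.mul_assoc, h.transfer_I_mul hi, mul_one]

theorem StronglyAdmissible.one_add_potential_eq (h : Q.StronglyAdmissible)
    (hi : I ∉ spectrum ℂ Q.α) :
    1 + Q.potential 0 = Q.next.transfer (-I) * (1 + sgn m₁ m₂) * (Q.transfer I)ᴴ := by
  rw [h.next_transfer_neg_I_mul, Matrix.mul_assoc, h.transfer_neg_I_mul hi, mul_one]

theorem StronglyAdmissible.next_Hplus_mul (h : Q.StronglyAdmissible)
    (hi : I ∉ spectrum ℂ Q.α) : Q.next.Hplus * (1 - Q.potential 0) = 0 := by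
  have e : (Q.next.transfer (-I))ᴴ * Q.next.transfer I = 1 :=
    mul_eq_one_comm.1 (h.next.transfer_I_mul hi)
  rw [Hplus, h.one_sub_potential_eq hi, Matrix.mul_assoc, ← Matrix.mul_assoc _ᴴ,
    ← Matrix.mul_assoc _ᴴ, e, Matrix.one_mul, Matrix.mul_assoc, ← Matrix.mul_assoc (1 + _),
    one_add_sgn_mul_one_sub_sgn, Matrix.zero_mul, Matrix.mul_zero]

theorem StronglyAdmissible.next_Hminus_mul (h : Q.StronglyAdmissible)
    (hi : I ∉ spectrum ℂ Q.α) : Q.next.Hminus * (1 + Q.potential 0) = 0 := by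
  have e : (Q.next.transfer I)ᴴ * Q.next.transfer (-I) = 1 :=
    mul_eq_one_comm.1 (h.next.transfer_neg_I_mul hi)
  rw [Hminus, h.one_add_potential_eq hi, Matrix.mul_assoc, ← Matrix.mul_assoc _ᴴ,
    ← Matrix.mul_assoc _ᴴ, e, Matrix.one_mul, Matrix.mul_assoc, ← Matrix.mul_assoc (1 - _),
    one_sub_sgn_mul_one_add_sgn, Matrix.zero_mul, Matrix.mul_zero]

/-- The adjoint of the factorization of $1+C$ puts $W(i)$ next to the $W(-i)^*$ ending the
factorization of $1-C$. These cancel, leaving $(1-j)(1+j)=0$. -/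
theorem StronglyAdmissible.potential_mul_self (h : Q.StronglyAdmissible)
    (hi : I ∉ spectrum ℂ Q.α) : Q.potential 0 * Q.potential 0 = 1 := by
  have h1 : 1 + Q.potential 0 = Q.transfer I * (1 + sgn m₁ m₂) * (Q.next.transfer (-I))ᴴ := by
    have := congrArg conjTranspose (h.one_add_potential_eq hi)
    simpa [h.isHermitian_potential.eq, Matrix.mul_assoc] using this
  have e : (Q.transfer (-I))ᴴ * Q.transfer I = 1 := mul_eq_one_comm.1 (h.transfer_I_mul hi)
  have h2 : (1 - Q.potential 0) * (1 + Q.potential 0) = 0 := by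
    rw [h1, h.one_sub_potential_eq hi, Matrix.mul_assoc, ← Matrix.mul_assoc _ᴴ,
      ← Matrix.mul_assoc _ᴴ, e, Matrix.one_mul, Matrix.mul_assoc, ← Matrix.mul_assoc (1 - _),
      one_sub_sgn_mul_one_add_sgn, Matrix.zero_mul, Matrix.mul_zero]
  have h3 : (1 - Q.potential 0) * (1 + Q.potential 0) = 1 - Q.potential 0 * Q.potential 0 := by
    noncomm_ring
  rw [h3, sub_eq_zero] at h2
  exact h2.symm

theorem StronglyAdmissible.exists_unitary (h : Q.StronglyAdmissible)
    (hi : I ∉ spectrum ℂ Q.α) :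
    ∃ U ∈ unitaryGroup (Fin m₁ ⊕ Fin m₂) ℂ, Q.potential 0 = U * sgn m₁ m₂ * Uᴴ := by
  have hCC := h.potential_mul_self hi
  have hp := h.next_transfer_neg_I_mul
  have hm := h.next_transfer_I_mul hi
  have up : (Q.next.transfer I)ᴴ * Q.next.transfer (-I) = 1 :=
    mul_eq_one_comm.1 (h.next.transfer_neg_I_mul hi)
  have um : (Q.next.transfer (-I))ᴴ * Q.next.transfer I = 1 :=
    mul_eq_one_comm.1 (h.next.transfer_I_mul hi)
  set C := Q.potential 0
  have cp : C * (1 + C) = 1 + C := by rw [mul_add, hCC, mul_one, add_comm]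
  have cm : C * (1 - C) = -(1 - C) := by rw [mul_sub, hCC, mul_one, neg_sub]
  have jp : (1 + sgn m₁ m₂) * sgn m₁ m₂ = 1 + sgn m₁ m₂ := by
    rw [add_mul, sgn_mul_sgn, one_mul, add_comm]
  have jm : (1 - sgn m₁ m₂) * sgn m₁ m₂ = -(1 - sgn m₁ m₂) := by
    rw [sub_mul, sgn_mul_sgn, one_mul, neg_sub]
  -- By the relations at $\pm i$, the two summands of `T` have ranges in the $+1$ and $-1$
  -- eigenspaces of $C$, so $CT=Tj$.
  refine h.isHermitian_potential.exists_unitary_of_mul_eq_mul (conjTranspose_sgn m₁ m₂)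
    (T := Q.next.transfer (-I) * (1 + sgn m₁ m₂) + Q.next.transfer I * (1 - sgn m₁ m₂)) ?_ ?_
  · rw [← mulVec_injective_iff_isUnit]
    refine (injective_iff_map_eq_zero (mulVecLin _)).2 fun v hv => ?_
    rw [mulVecLin_apply] at hv
    have cp2 : (1 + C) * (1 + C) = (2 : ℂ) • (1 + C) := by
      rw [add_mul, cp, one_mul, two_smul]
    have cm2 : (1 - C) * (1 - C) = (2 : ℂ) • (1 - C) := by
      rw [sub_mul, cm, one_mul, two_smul, sub_neg_eq_add]
    have cpm : (1 + C) * (1 - C) = 0 := by rw [add_mul, cm, one_mul, add_neg_cancel]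
    have cmp : (1 - C) * (1 + C) = 0 := by rw [sub_mul, cp, one_mul, sub_self]
    -- Multiplying by $1+C$ kills the second summand of $Tv$ and doubles the first; the adjoint
    -- transfer matrix then removes $W(-i)$ of the next quadruple.
    have e1 : (1 + sgn m₁ m₂) *ᵥ v = 0 := by
      have := congrArg (fun x => ((Q.next.transfer I)ᴴ * (1 + C)) *ᵥ x) hv
      simp only [mulVec_mulVec, mulVec_zero] at this
      rw [Matrix.mul_assoc, Matrix.mul_add, hp, hm, ← Matrix.mul_assoc (1 + C) (1 + C),
        ← Matrix.mul_assoc (1 + C) (1 - C), cp2, cpm, Matrix.zero_mul, add_zero, Matrix.smul_mul,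
        ← hp, Matrix.mul_smul, ← Matrix.mul_assoc, up, Matrix.one_mul, smul_mulVec] at this
      exact (smul_eq_zero_iff_right two_ne_zero).1 this
    have e2 : (1 - sgn m₁ m₂) *ᵥ v = 0 := by
      have := congrArg (fun x => ((Q.next.transfer (-I))ᴴ * (1 - C)) *ᵥ x) hv
      simp only [mulVec_mulVec, mulVec_zero] at this
      rw [Matrix.mul_assoc, Matrix.mul_add, hp, hm, ← Matrix.mul_assoc (1 - C) (1 + C),
        ← Matrix.mul_assoc (1 - C) (1 - C), cm2, cmp, Matrix.zero_mul, zero_add, Matrix.smul_mul,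
        ← hm, Matrix.mul_smul, ← Matrix.mul_assoc, um, Matrix.one_mul, smul_mulVec] at this
      exact (smul_eq_zero_iff_right two_ne_zero).1 this
    rw [add_mulVec, one_mulVec] at e1
    rw [sub_mulVec, one_mulVec] at e2
    have e3 : (2 : ℂ) • v = 0 := by
      have := congrArg₂ (· + ·) e1 e2
      simp only [add_zero] at this
      rw [← this]
      module
    exact (smul_eq_zero_iff_right two_ne_zero).1 e3
  · rw [mul_add, add_mul, Matrix.mul_assoc _ (1 + sgn m₁ m₂), Matrix.mul_assoc _ (1 - sgn m₁ m₂),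
      jp, jm, hp, hm, Matrix.mul_neg, hm, ← Matrix.mul_assoc, ← Matrix.mul_assoc, cp, cm,
      Matrix.neg_mul]

end Quadruple

/-! ### Evolution in $t$ and the Heisenberg magnet equation -/

namespace Quadruple

open Matrix Complex

variable {n m₁ m₂ : ℕ} {Q : Quadruple n m₁ m₂}

section Evolution

/-- For singular $A$ both inverses are zero by convention, so no invertibility is required. -/
theorem _root_.Matrix.inv_neg_eq (A : Matrix (Fin n) (Fin n) ℂ) : (-A)⁻¹ = -A⁻¹ := by
  by_cases hA : IsUnit A.det
  · simpa using Matrix.inv_smul' (A := A) (-1 : ℂˣ) hA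
  · have hA' : ¬ IsUnit (-A).det := by rwa [← isUnit_iff_isUnit_det, IsUnit.neg_iff,
      isUnit_iff_isUnit_det]
    rw [nonsing_inv_apply_not_isUnit _ hA, nonsing_inv_apply_not_isUnit _ hA', neg_zero]

theorem transfer_I_eq (Q : Quadruple n m₁ m₂) :
    Q.transfer I = 1 - I • (Q.Lamᴴ * Q.S⁻¹ * (Q.α - I • 1)⁻¹ * Q.Lam) := by
  rw [transfer, ← neg_sub, Matrix.inv_neg_eq]
  simp [sub_eq_add_neg]

theorem transfer_neg_I_eq (Q : Quadruple n m₁ m₂) :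
    Q.transfer (-I) = 1 - I • (Q.Lamᴴ * Q.S⁻¹ * (Q.α + I • 1)⁻¹ * Q.Lam) := by
  rw [transfer, ← neg_sub, Matrix.inv_neg_eq, neg_smul, sub_neg_eq_add]
  simp [sub_eq_add_neg]

theorem lamRHS_eq (Q : Quadruple n m₁ m₂) :
    Q.lamRHS = -(((Q.α - I • 1)⁻¹ + (Q.α + I • 1)⁻¹) * Q.Lam) -
      ((Q.α - I • 1)⁻¹ - (Q.α + I • 1)⁻¹) * (Q.Lam * sgn m₁ m₂) := by
  simp only [lamRHS, proj₁, proj₂, Matrix.mul_smul, Matrix.mul_add, Matrix.mul_sub,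
    Matrix.add_mul, Matrix.sub_mul, Matrix.mul_one, Matrix.mul_assoc]
  module

theorem isUnit_det_sub_I (hi : I ∉ spectrum ℂ Q.α) : IsUnit (Q.α - I • 1).det := by
  rw [← isUnit_iff_isUnit_det, ← neg_sub]
  exact (isUnit_sub_of_notMem_spectrum hi).neg

theorem isUnit_det_add_I (hi : -I ∉ spectrum ℂ Q.α) : IsUnit (Q.α + I • 1).det := by
  rw [← isUnit_iff_isUnit_det]
  have := (isUnit_sub_of_notMem_spectrum hi).neg
  rwa [neg_sub, neg_smul, sub_neg_eq_add] at this

/-- Partial fractions: $\alpha^2+I=(\alpha-iI)(\alpha+iI)$ lets everything be written in the two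
resolvents that also drive $\Lambda$. -/
theorem sRHS_eq (hi : I ∉ spectrum ℂ Q.α) (hi' : -I ∉ spectrum ℂ Q.α) :
    Q.sRHS = -(((Q.α - I • 1)⁻¹ + (Q.α + I • 1)⁻¹) * Q.S +
      Q.S * (((Q.α - I • 1)⁻¹)ᴴ + ((Q.α + I • 1)⁻¹)ᴴ) -
      I • ((Q.α - I • 1)⁻¹ * (Q.Lam * sgn m₁ m₂ * Q.Lamᴴ) * ((Q.α + I • 1)⁻¹)ᴴ -
        (Q.α + I • 1)⁻¹ * (Q.Lam * sgn m₁ m₂ * Q.Lamᴴ) * ((Q.α - I • 1)⁻¹)ᴴ)) := by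
  have hm := isUnit_det_sub_I hi
  have hp := isUnit_det_add_I hi'
  have e1 : (Q.αᴴ + I • 1)⁻¹ = ((Q.α - I • 1)⁻¹)ᴴ := by
    rw [conjTranspose_nonsing_inv]
    simp
  have e2 : (Q.αᴴ - I • 1)⁻¹ = ((Q.α + I • 1)⁻¹)ᴴ := by
    rw [conjTranspose_nonsing_inv]
    simp [sub_eq_add_neg]
  have f : Q.α ^ 2 + 1 = (Q.α - I • 1) * (Q.α + I • 1) := by
    simp only [sub_mul, mul_add, Matrix.mul_smul, Matrix.smul_mul, smul_smul, sq, mul_one, one_mul,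
      I_mul_I]
    module
  have f' : Q.α ^ 2 + 1 = (Q.α + I • 1) * (Q.α - I • 1) := by
    simp only [add_mul, mul_sub, Matrix.mul_smul, Matrix.smul_mul, smul_smul, sq, mul_one, one_mul,
      I_mul_I]
    module
  have e3 : (Q.αᴴ ^ 2 + 1)⁻¹ = ((Q.α ^ 2 + 1)⁻¹)ᴴ := by
    rw [conjTranspose_nonsing_inv]
    simp
  have g1 : (Q.α ^ 2 + 1)⁻¹ * (Q.α + I • 1) = (Q.α - I • 1)⁻¹ := by
    rw [f', Matrix.mul_inv_rev, Matrix.mul_assoc, nonsing_inv_mul _ hp, mul_one]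
  have g2 : (Q.α ^ 2 + 1)⁻¹ * (Q.α - I • 1) = (Q.α + I • 1)⁻¹ := by
    rw [f, Matrix.mul_inv_rev, Matrix.mul_assoc, nonsing_inv_mul _ hm, mul_one]
  rw [sRHS, e1, e2, e3, ← g1, ← g2]
  generalize (Q.α ^ 2 + 1)⁻¹ = G
  simp only [conjTranspose_mul, conjTranspose_add, conjTranspose_sub, conjTranspose_smul,
    Complex.star_def, conj_I, Matrix.mul_add, Matrix.add_mul, Matrix.mul_sub,
    Matrix.sub_mul, Matrix.mul_smul, Matrix.smul_mul, Matrix.mul_one, smul_smul,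
    smul_add, smul_sub, Matrix.mul_assoc]
  match_scalars <;> ring_nf <;> simp

/-- The time derivative of `Λ* S⁻¹ Λ` along the flow, expressed through `H⁺` and `H⁻`. -/
theorem StronglyAdmissible.I_smul_deriv_eq (h : Q.StronglyAdmissible)
    (hi : I ∉ spectrum ℂ Q.α) :
    I • ((Q.lamRHSᴴ * Q.S⁻¹ + Q.Lamᴴ * (-(Q.S⁻¹ * Q.sRHS * Q.S⁻¹))) * Q.Lam +
      Q.Lamᴴ * Q.S⁻¹ * Q.lamRHS) = Q.Hplus + Q.Hminus - (2 : ℂ) • 1 := by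
  have hS := h.1.1
  have hi' := h.neg_I_notMem
  -- The parts of $H^\pm$ without $j$ are $W(\pm i)W(\mp i)^*=I$ and account for the $2I$.
  have hH : Q.Hplus + Q.Hminus - (2 : ℂ) • 1 =
      Q.transfer I * sgn m₁ m₂ * (Q.transfer (-I))ᴴ -
        Q.transfer (-I) * sgn m₁ m₂ * (Q.transfer I)ᴴ := by
    rw [Hplus, Hminus, mul_add, mul_sub, add_mul, sub_mul, mul_one, mul_one, h.transfer_I_mul hi,
      h.transfer_neg_I_mul hi]
    module
  have hSd : IsUnit Q.S.det := (isUnit_iff_isUnit_det _).1 hS.isUnit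
  have hT : (Q.S⁻¹)ᴴ = Q.S⁻¹ := hS.inv.isHermitian.eq
  have s1 : ∀ {p : Type} (x : Matrix (Fin n) p ℂ), Q.S⁻¹ * (Q.S * x) = x :=
    fun x => nonsing_inv_mul_cancel_left _ x hSd
  have s2 : ∀ {p : Type} (x : Matrix (Fin n) p ℂ), Q.S * (Q.S⁻¹ * x) = x :=
    fun x => mul_nonsing_inv_cancel_left _ x hSd
  rw [hH, transfer_I_eq, transfer_neg_I_eq, lamRHS_eq, sRHS_eq hi hi']
  generalize (Q.α - I • 1)⁻¹ = R
  generalize (Q.α + I • 1)⁻¹ = R'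
  generalize Q.S⁻¹ = T at *
  simp only [conjTranspose_mul, conjTranspose_add, conjTranspose_sub, conjTranspose_smul,
    conjTranspose_one, conjTranspose_neg, conjTranspose_sgn, conjTranspose_conjTranspose, hT,
    Complex.star_def, conj_I, Matrix.mul_add, Matrix.add_mul, Matrix.mul_sub, Matrix.neg_mul,
    Matrix.mul_neg, Matrix.sub_mul, Matrix.mul_smul, Matrix.smul_mul, Matrix.mul_one,
    Matrix.one_mul, smul_smul, smul_add, smul_sub, smul_neg, Matrix.mul_assoc, s1, s2]
  match_scalars <;> ring_nf

/-- The equation for $S$ is compatible with differentiating the Lyapunov equation along the flow of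
$\Lambda$. -/
theorem lyapunov_sRHS (hi : I ∉ spectrum ℂ Q.α) (hi' : -I ∉ spectrum ℂ Q.α)
    (h : Q.α * Q.S - Q.S * Q.αᴴ = I • (Q.Lam * Q.Lamᴴ)) :
    lyapunov Q.α Q.sRHS = I • (Q.lamRHS * Q.Lamᴴ + Q.Lam * Q.lamRHSᴴ) := by
  have hm := isUnit_det_sub_I hi
  have hp := isUnit_det_add_I hi'
  rw [lyapunov_apply, sRHS_eq hi hi', lamRHS_eq]
  have m1 := mul_nonsing_inv _ hm
  have m2 := nonsing_inv_mul _ hm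
  have p1 := mul_nonsing_inv _ hp
  have p2 := nonsing_inv_mul _ hp
  generalize (Q.α - I • 1)⁻¹ = R at *
  generalize (Q.α + I • 1)⁻¹ = R' at *
  rw [sub_mul, Matrix.smul_mul, one_mul, sub_eq_iff_eq_add] at m1
  rw [mul_sub, Matrix.mul_smul, mul_one, sub_eq_iff_eq_add] at m2
  rw [add_mul, Matrix.smul_mul, one_mul, ← eq_sub_iff_add_eq] at p1
  rw [mul_add, Matrix.mul_smul, mul_one, ← eq_sub_iff_add_eq] at p2
  have m3 : Rᴴ * Q.αᴴ = 1 + (-I) • Rᴴ := by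
    rw [← conjTranspose_mul, m1]; simp
  have p3 : R'ᴴ * Q.αᴴ = 1 - (-I) • R'ᴴ := by
    rw [← conjTranspose_mul, p1]; simp
  have m4 : Q.αᴴ * Rᴴ = 1 + (-I) • Rᴴ := by
    rw [← conjTranspose_mul, m2]; simp
  have p4 : Q.αᴴ * R'ᴴ = 1 - (-I) • R'ᴴ := by
    rw [← conjTranspose_mul, p2]; simp
  have a1 : ∀ x, Q.α * (R * x) = x + I • (R * x) := fun x => by
    rw [← mul_assoc, m1, add_mul, one_mul, Matrix.smul_mul]
  have a2 : ∀ x, Q.α * (R' * x) = x - I • (R' * x) := fun x => by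
    rw [← mul_assoc, p1, sub_mul, one_mul, Matrix.smul_mul]
  have a3 : ∀ x, R * (Q.α * x) = x + I • (R * x) := fun x => by
    rw [← mul_assoc, m2, add_mul, one_mul, Matrix.smul_mul]
  have a4 : ∀ x, R' * (Q.α * x) = x - I • (R' * x) := fun x => by
    rw [← mul_assoc, p2, sub_mul, one_mul, Matrix.smul_mul]
  generalize hM : Q.Lam * sgn m₁ m₂ * Q.Lamᴴ = M
  have hM1 : ∀ Y : Matrix (Fin n) (Fin n) ℂ,
      Y * (Q.Lam * sgn m₁ m₂) * Q.Lamᴴ = Y * M := by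
    intro Y; rw [← hM]; simp only [Matrix.mul_assoc]
  have hM2 : ∀ Y : Matrix (Fin n) (Fin n) ℂ,
      Q.Lam * (sgn m₁ m₂ * Q.Lamᴴ * Y) = M * Y := by
    intro Y; rw [← hM]; simp only [Matrix.mul_assoc]
  generalize hNN : Q.Lam * Q.Lamᴴ = N at h
  have hN1 : ∀ Y : Matrix (Fin n) (Fin n) ℂ, Y * Q.Lam * Q.Lamᴴ = Y * N := by
    intro Y; rw [← hNN]; simp only [Matrix.mul_assoc]
  have hN2 : ∀ Y : Matrix (Fin n) (Fin n) ℂ, Q.Lam * (Q.Lamᴴ * Y) = N * Y := by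
    intro Y; rw [← hNN]; simp only [Matrix.mul_assoc]
  have hS1 : Q.S * Q.αᴴ = Q.α * Q.S - I • N := by rw [← h]; abel
  have hS2 : ∀ x, Q.α * (Q.S * x) = Q.S * (Q.αᴴ * x) + I • (N * x) := fun x => by
    rw [← Matrix.smul_mul, ← h, ← mul_assoc, ← mul_assoc, ← add_mul]
    simp
  simp only [conjTranspose_mul, conjTranspose_add, conjTranspose_sub, conjTranspose_neg,
    conjTranspose_sgn, Matrix.sub_mul, Matrix.mul_sub, Matrix.mul_neg, Matrix.neg_mul,
    hM1, hM2, hN1, hN2]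
  simp only [Matrix.mul_add, Matrix.add_mul, Matrix.mul_sub, Matrix.mul_one, Matrix.sub_mul,
    Matrix.mul_smul, Matrix.smul_mul, Matrix.mul_assoc,
    a1, a2, a3, a4, m3, m4, p3, p4, hS1, hS2]
  module

/-- The Lyapunov equation turns the evolution equation of `Λ` into that of `S`. -/
theorem hasDerivAt_S_of_lyapunov {F : ℝ → Quadruple n m₁ m₂} {A : Matrix (Fin n) (Fin n) ℂ} {t : ℝ}
    (hA : Function.Injective (lyapunov A)) (hi : I ∉ spectrum ℂ A) (hi' : -I ∉ spectrum ℂ A)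
    (hα : ∀ t, (F t).α = A)
    (hL : ∀ t, A * (F t).S - (F t).S * Aᴴ = I • ((F t).Lam * (F t).Lamᴴ))
    (hΛ : HasDerivAt (fun s => (F s).Lam) (F t).lamRHS t) :
    HasDerivAt (fun s => (F s).S) (F t).sRHS t := by
  let e := LinearEquiv.ofInjectiveEndo (lyapunov A) hA
  have he : ∀ X, e X = A * X - X * Aᴴ := fun X => rfl
  have h1 : (fun s => (F s).S) = fun s => e.symm (I • ((F s).Lam * (F s).Lamᴴ)) := by
    funext s
    rw [LinearEquiv.eq_symm_apply, he, hL]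
  have h2 : (F t).sRHS =
      e.symm (I • ((F t).lamRHS * (F t).Lamᴴ + (F t).Lam * (F t).lamRHSᴴ)) := by
    rw [LinearEquiv.eq_symm_apply, ← lyapunov_sRHS (by rwa [hα]) (by rwa [hα])
      (by rw [hα]; exact hL t), hα]
    rfl
  rw [h1, h2]
  exact hasDerivAt_linearMap e.symm.toLinearMap
    (hasDerivAt_const_smul I (hasDerivAt_mul hΛ (hasDerivAt_conjTranspose hΛ)))

/-- The discrete step and the flow act on $\Lambda$ through functions of $\alpha$ on the left and of
$j$ on the right, hence commute; every $\Lambda_k$ obeys the same equation. -/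
theorem next_lamRHS (Q : Quadruple n m₁ m₂) :
    Q.next.lamRHS = Q.lamRHS + I • (Q.α⁻¹ * Q.lamRHS * sgn m₁ m₂) := by
  have comm : ∀ (z : ℂ) (x : Matrix (Fin n) (Fin m₁ ⊕ Fin m₂) ℂ),
        (Q.α + z • 1)⁻¹ * (Q.α⁻¹ * x) = Q.α⁻¹ * ((Q.α + z • 1)⁻¹ * x) := by
    intro z x
    rw [← Matrix.mul_assoc, ← Matrix.mul_assoc, ← Matrix.mul_inv_rev, ← Matrix.mul_inv_rev]
    simp [mul_add, add_mul]
  have hn : Q.next.α = Q.α := rfl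
  have c1 := comm I
  have c2 := comm (-I)
  simp only [neg_smul, ← sub_eq_add_neg] at c2
  rw [lamRHS_eq, lamRHS_eq, lam_next, hn]
  simp only [Matrix.mul_add, Matrix.add_mul, Matrix.mul_sub, Matrix.neg_mul,
    Matrix.mul_neg, Matrix.sub_mul, Matrix.mul_smul, Matrix.smul_mul, Matrix.mul_assoc, c1, c2,
    sgn_mul_sgn, Matrix.mul_one]
  module

theorem hasDerivAt_next_lam {F : ℝ → Quadruple n m₁ m₂} {A : Matrix (Fin n) (Fin n) ℂ} {t : ℝ}
    (hα : ∀ t, (F t).α = A) (hΛ : HasDerivAt (fun s => (F s).Lam) (F t).lamRHS t) :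
    HasDerivAt (fun s => (F s).next.Lam) (F t).next.lamRHS t := by
  rw [next_lamRHS]
  simp only [lam_next, hα]
  exact hasDerivAt_add hΛ
    (hasDerivAt_const_smul I (hasDerivAt_mul_const (hasDerivAt_const_mul _ hΛ) _))

theorem hasDerivAt_seq_lam {F : ℝ → Quadruple n m₁ m₂} {A : Matrix (Fin n) (Fin n) ℂ} {t : ℝ}
    (hα : ∀ t, (F t).α = A) (hΛ : HasDerivAt (fun s => (F s).Lam) (F t).lamRHS t) (k : ℕ) :
    HasDerivAt (fun s => ((F s).seq k).Lam) ((F t).seq k).lamRHS t := by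
  induction k with
  | zero => exact hΛ
  | succ k ih =>
    exact hasDerivAt_next_lam (F := fun s => (F s).seq k)
      (fun t => (seq_alpha _ _).trans (hα t)) ih

/-- Along a flow of strongly admissible quadruples, `i (Λ* S⁻¹ Λ)' = H⁺ + H⁻ - 2`. -/
theorem exists_hasDerivAt_lam_inv_S_lam {F : ℝ → Quadruple n m₁ m₂} {t : ℝ}
    (h : (F t).StronglyAdmissible) (hi : I ∉ spectrum ℂ (F t).α)
    (hΛ : HasDerivAt (fun s => (F s).Lam) (F t).lamRHS t)
    (hS : HasDerivAt (fun s => (F s).S) (F t).sRHS t) :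
    ∃ D, HasDerivAt (fun s => (F s).Lamᴴ * (F s).S⁻¹ * (F s).Lam) D t ∧
      I • D = (F t).Hplus + (F t).Hminus - (2 : ℂ) • 1 :=
  ⟨_, hasDerivAt_mul (hasDerivAt_mul (hasDerivAt_conjTranspose hΛ)
    (hasDerivAt_inv hS h.1.1.isUnit)) hΛ, h.I_smul_deriv_eq hi⟩

theorem isDGHM_of_flow {F : ℝ → Quadruple n m₁ m₂} {A : Matrix (Fin n) (Fin n) ℂ}
    (hi : I ∉ spectrum ℂ A) (hα : ∀ t, (F t).α = A) (h : ∀ t, (F t).StronglyAdmissible)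
    (hΛ : ∀ t, HasDerivAt (fun s => (F s).Lam) (F t).lamRHS t) :
    IsDGHM m₁ m₂ (fun k t => (F t).potential k)
      (fun k t => ((F t).seq k).Hplus) (fun k t => ((F t).seq k).Hminus) := by
  have hα' : ∀ k t, ((F t).seq k).α = A := fun k t => (seq_alpha _ _).trans (hα t)
  have hi' : ∀ k t, I ∉ spectrum ℂ ((F t).seq k).α := fun k t => by rwa [hα']
  have hk : ∀ k t, ((F t).seq k).StronglyAdmissible := fun k t => (h t).seq k
  have hn : -I ∉ spectrum ℂ A := hα 0 ▸ (h 0).neg_I_notMem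
  have hinj : Function.Injective (lyapunov A) := hα 0 ▸ lyapunov_injective (h 0).1.1
    (posSemidef_self_mul_conjTranspose (F 0).ϑ₂) (h 0).2 (h 0).1.2
  have hY : ∀ k t, ∃ D, HasDerivAt (fun s => ((F s).seq k).Lamᴴ * ((F s).seq k).S⁻¹ *
      ((F s).seq k).Lam) D t ∧
      I • D = ((F t).seq k).Hplus + ((F t).seq k).Hminus - (2 : ℂ) • 1 := by
    intro k t
    -- The derivative of $S_k$ comes from its own Lyapunov equation, not from differentiating the
    -- recursion.
    have hΛk := hasDerivAt_seq_lam hα (hΛ t) k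
    exact exists_hasDerivAt_lam_inv_S_lam (F := fun s => (F s).seq k) (hk k t) (hi' k t) hΛk
      (hasDerivAt_S_of_lyapunov (F := fun s => (F s).seq k) hinj hi hn (hα' k)
        (fun s => by rw [← hα' k s]; exact (hk k s).lyapunov_eq) hΛk)
  have ml : ∀ k t, (1 + (F t).potential k) * ((F t).seq k).Hminus = 0 :=
    fun k t => (hk k t).one_add_potential_mul_Hminus
  have mr : ∀ k t, ((F t).seq (k + 1)).Hminus * (1 + (F t).potential k) = 0 :=
    fun k t => (hk k t).next_Hminus_mul (hi' k t)
  have pl : ∀ k t, (1 - (F t).potential k) * ((F t).seq k).Hplus = 0 :=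
    fun k t => (hk k t).one_sub_potential_mul_Hplus (hi' k t)
  have pr : ∀ k t, ((F t).seq (k + 1)).Hplus * (1 - (F t).potential k) = 0 :=
    fun k t => (hk k t).next_Hplus_mul (hi' k t)
  refine ⟨fun k t => ?_, ml, mr, pl, pr, fun k t => (hk k t).exists_unitary (hi' k t)⟩
  obtain ⟨D, hD, hID⟩ := hY k t
  obtain ⟨D', hD', hID'⟩ := hY (k + 1) t
  have hc : HasDerivAt (fun _ : ℝ => sgn m₁ m₂) 0 t :=
    hasDerivAt_iff_apply.2 fun i j => hasDerivAt_const t (sgn m₁ m₂ i j)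
  refine ⟨0 + D - D', hasDerivAt_sub (hasDerivAt_add hc hD) hD', ?_⟩
  have ml := ml k t
  have mr := mr k t
  have pl := pl k t
  have pr := pr k t
  -- The annihilation relations now read $CH_k^\pm=\pm H_k^\pm$ and $H_{k+1}^\pm C=\pm H_{k+1}^\pm$,
  -- so the right-hand side collapses to $H_k^++H_k^--H_{k+1}^+-H_{k+1}^-$.
  simp only [mul_add, add_mul, mul_sub, sub_mul, mul_one, one_mul] at ml mr pl pr
  rw [zero_add, smul_sub, hID, hID', sub_mul, mul_sub, eq_neg_of_add_eq_zero_right ml,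
    eq_neg_of_add_eq_zero_right mr, ← sub_eq_zero.1 pl, ← sub_eq_zero.1 pr]
  abel

end Evolution

end Quadruple

/-! ### Existence and uniqueness of the flow -/

namespace Quadruple

open Matrix Complex

variable {n m₁ m₂ : ℕ} {Q : Quadruple n m₁ m₂}

theorem lamRHS_eq_fromCols (Q : Quadruple n m₁ m₂) :
    Q.lamRHS = fromCols (((-2 : ℂ) • (Q.α - I • 1)⁻¹) * Q.ϑ₁)
      (((-2 : ℂ) • (Q.α + I • 1)⁻¹) * Q.ϑ₂) := by
  simp only [lamRHS, proj₁, proj₂, Lam, sgn, mul_fromCols, Matrix.mul_smul, Matrix.mul_add,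
    Matrix.mul_sub, fromCols_mul_fromBlocks]
  ext a (b | b) <;> simp <;> ring

theorem _root_.Matrix.commute_inv_add_smul_one (A : Matrix (Fin n) (Fin n) ℂ) (z : ℂ)
    (hz : IsUnit (A + z • 1)) : Commute A (A + z • 1)⁻¹ := by
  have hzd := (isUnit_iff_isUnit_det _).1 hz
  have h1 : (A + z • 1)⁻¹ * A = 1 - z • (A + z • 1)⁻¹ := by
    have := nonsing_inv_mul _ hzd
    rwa [mul_add, Matrix.mul_smul, mul_one, ← eq_sub_iff_add_eq] at this
  have h2 : A * (A + z • 1)⁻¹ = 1 - z • (A + z • 1)⁻¹ := by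
    have := mul_nonsing_inv _ hzd
    rwa [add_mul, Matrix.smul_mul, one_mul, ← eq_sub_iff_add_eq] at this
  exact h2.trans h1.symm

theorem StronglyAdmissible.lyapunov_injective (h : Q.StronglyAdmissible) :
    Function.Injective (lyapunov Q.α) :=
  _root_.lyapunov_injective h.1.1 (posSemidef_self_mul_conjTranspose Q.ϑ₂) h.2 h.1.2

/-- Existence of the flow, through strongly admissible quadruples. -/
theorem StronglyAdmissible.exists_isFlow (h : Q.StronglyAdmissible) (hi : I ∉ spectrum ℂ Q.α) :
    ∃ F, Q.IsFlow F ∧ ∀ t, (F t).StronglyAdmissible := by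
  have hinj := h.lyapunov_injective
  let e := LinearEquiv.ofInjectiveEndo (lyapunov Q.α) hinj
  have he : ∀ X, e X = Q.α * X - X * Q.αᴴ := fun X => rfl
  let G₁ := (-2 : ℂ) • (Q.α - I • 1)⁻¹
  let G₂ := (-2 : ℂ) • (Q.α + I • 1)⁻¹
  let x (t : ℝ) := NormedSpace.exp (t • G₁) * Q.ϑ₁
  let y (t : ℝ) := NormedSpace.exp (t • G₂) * Q.ϑ₂
  -- $S$ is defined as the solution of the Lyapunov equation, which holds for all $t$ by
  -- construction; its differential equation is deduced afterwards.
  let F (t : ℝ) : Quadruple n m₁ m₂ :=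
    ⟨Q.α, e.symm (I • (fromCols (x t) (y t) * (fromCols (x t) (y t))ᴴ)), x t, y t⟩
  have hL : ∀ t, Q.α * (F t).S - (F t).S * Q.αᴴ = I • ((F t).Lam * (F t).Lamᴴ) := by
    intro t
    rw [← he, LinearEquiv.apply_symm_apply]
    rfl
  have hΛ : ∀ t, HasDerivAt (fun s => (F s).Lam) (F t).lamRHS t := by
    intro t
    rw [lamRHS_eq_fromCols]
    have hx : HasDerivAt x (G₁ * x t) t := by
      have := hasDerivAt_mul_const (hasDerivAt_exp_smul (t := t) G₁) Q.ϑ₁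
      rwa [Matrix.mul_assoc] at this
    have hy : HasDerivAt y (G₂ * y t) t := by
      have := hasDerivAt_mul_const (hasDerivAt_exp_smul (t := t) G₂) Q.ϑ₂
      rwa [Matrix.mul_assoc] at this
    refine hasDerivAt_iff_apply.2 ?_
    rintro a (b | b)
    · exact hasDerivAt_iff_apply.1 hx a b
    · exact hasDerivAt_iff_apply.1 hy a b
  have h0 : F 0 = Q := by
    have hx0 : x 0 = Q.ϑ₁ := by simp [x]
    have hy0 : y 0 = Q.ϑ₂ := by simp [y]
    refine Quadruple.ext rfl (hinj ?_) hx0 hy0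
    rw [lyapunov_apply, lyapunov_apply, hL, h.lyapunov_eq]
    change I • (fromCols (x 0) (y 0) * (fromCols (x 0) (y 0))ᴴ) = _
    rw [hx0, hy0]
    rfl
  refine ⟨F, ⟨h0, fun _ => rfl, hΛ, fun t => ?_⟩, fun t => ?_⟩
  · exact hasDerivAt_S_of_lyapunov hinj hi h.neg_I_notMem (fun _ => rfl) hL (hΛ t)
  · have hu : IsUnit (Q.α + (-I) • 1) := by
      have := (isUnit_sub_of_notMem_spectrum hi).neg
      rwa [neg_sub, sub_eq_add_neg, ← neg_smul] at this
    have hG : Commute Q.α (NormedSpace.exp (t • G₁)) := by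
      have := commute_inv_add_smul_one Q.α (-I) hu
      rw [neg_smul, ← sub_eq_add_neg] at this
      exact ((this.smul_right (-2 : ℂ)).smul_right t).exp_right
    have hc : Controllable Q.α (x t) := h.2.mul_of_commute (Matrix.isUnit_exp _) hG
    have hLt := hL t
    refine stronglyAdmissible_iff.2 ⟨?_, hLt, hc⟩
    -- $S^*$ solves the same equation, so uniqueness gives $S=S^*$.
    have hH : (F t).S.IsHermitian := by
      apply hinj
      have := congrArg conjTranspose hLt
      simp only [conjTranspose_sub, conjTranspose_mul, conjTranspose_conjTranspose,
        conjTranspose_smul, Complex.star_def, conj_I, neg_smul] at this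
      rw [lyapunov_apply, lyapunov_apply, hLt, ← neg_sub, this, neg_neg]
    rw [lam_mul_conjTranspose_lam] at hLt
    exact posDef_of_lyapunov h.1.1 ((posSemidef_self_mul_conjTranspose Q.ϑ₁).add
      (posSemidef_self_mul_conjTranspose Q.ϑ₂)) h.1.2 hc
      (posSemidef_self_mul_conjTranspose (y t)) hH hLt

theorem IsFlow.lam_eq {F F' : ℝ → Quadruple n m₁ m₂} (hF : Q.IsFlow F) (hF' : Q.IsFlow F') :
    (fun t => (F t).Lam) = fun t => (F' t).Lam := by
  let T : Matrix (Fin n) (Fin m₁ ⊕ Fin m₂) ℂ →ₗ[ℂ] Matrix (Fin n) (Fin m₁ ⊕ Fin m₂) ℂ :=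
    { toFun := fun L => (-2 : ℂ) • ((Q.α - I • 1)⁻¹ * L * proj₁ m₁ m₂
        + (Q.α + I • 1)⁻¹ * L * proj₂ m₁ m₂)
      map_add' := fun L L' => by
        simp only [Matrix.mul_add, Matrix.add_mul]
        module
      map_smul' := fun c L => by
        simp only [Matrix.mul_smul, Matrix.smul_mul, RingHom.id_apply]
        module }
  have hT : ∀ {F : ℝ → Quadruple n m₁ m₂}, Q.IsFlow F → ∀ t, (F t).lamRHS = T (F t).Lam := by
    intro F hF t
    rw [lamRHS, hF.alpha_const]
    rfl
  refine eq_of_hasDerivAt_linearMap T (fun t => ?_) (fun t => ?_) ?_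
  · exact hT hF t ▸ hF.lam_deriv t
  · exact hT hF' t ▸ hF'.lam_deriv t
  · simp only [hF.init, hF'.init]

/-- Once $\Lambda$ is known, the equation for $S$ is affine, so the difference of two solutions
satisfies a homogeneous linear equation with zero initial value. -/
theorem IsFlow.S_eq {F F' : ℝ → Quadruple n m₁ m₂} (hF : Q.IsFlow F) (hF' : Q.IsFlow F')
    (t : ℝ) : (F t).S = (F' t).S := by
  let T : Matrix (Fin n) (Fin n) ℂ →ₗ[ℂ] Matrix (Fin n) (Fin n) ℂ :=
    { toFun := fun S => -((Q.α - I • 1)⁻¹ * S + (Q.α + I • 1)⁻¹ * S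
        + S * (Q.αᴴ + I • 1)⁻¹ + S * (Q.αᴴ - I • 1)⁻¹)
      map_add' := fun L L' => by
        simp only [Matrix.mul_add, Matrix.add_mul]
        module
      map_smul' := fun c L => by
        simp only [Matrix.mul_smul, Matrix.smul_mul, RingHom.id_apply]
        module }
  have hT : ∀ t, (F t).sRHS - (F' t).sRHS = T ((F t).S - (F' t).S) := by
    intro t
    have hl : (F t).Lam = (F' t).Lam := congrFun (hF.lam_eq hF') t
    rw [map_sub, sRHS, sRHS, hF.alpha_const, hF'.alpha_const, hl]
    simp only [T, LinearMap.coe_mk, AddHom.coe_mk]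
    abel
  have h0 : (fun s => (F s).S - (F' s).S) = fun _ => 0 := by
    refine eq_of_hasDerivAt_linearMap T (fun t => ?_) (fun t => ?_) ?_
    · exact hT t ▸ hasDerivAt_sub (hF.s_deriv t) (hF'.s_deriv t)
    · rw [map_zero]
      exact hasDerivAt_iff_apply.2 fun i j => hasDerivAt_const t 0
    · simp only [hF.init, hF'.init, sub_self]
  exact sub_eq_zero.1 (congrFun h0 t)

theorem IsFlow.unique {F F' : ℝ → Quadruple n m₁ m₂} (hF : Q.IsFlow F) (hF' : Q.IsFlow F') :
    F = F' := by
  funext t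
  have hl : (F t).Lam = (F' t).Lam := congrFun (hF.lam_eq hF') t
  obtain ⟨h1, h2⟩ := fromCols_inj hl
  exact Quadruple.ext ((hF.alpha_const t).trans (hF'.alpha_const t).symm) (hF.S_eq hF' t) h1 h2

end Quadruple

theorem theorem4p2 {n m₁ m₂ : ℕ} (Q : Quadruple n m₁ m₂)
    (hQ : Q.StronglyAdmissible) (hi : Complex.I ∉ spectrum ℂ Q.α) :
    0 ∉ spectrum ℂ Q.α ∧ -Complex.I ∉ spectrum ℂ Q.α ∧
    ∃ F : ℝ → Quadruple n m₁ m₂, Q.IsFlow F ∧ (∀ F', Q.IsFlow F' → F' = F) ∧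
      (∀ t k, ((F t).seq k).StronglyAdmissible) ∧
      IsDGHM m₁ m₂ (fun k t => (F t).potential k)
        (fun k t => ((F t).seq k).Hplus) (fun k t => ((F t).seq k).Hminus) := by
  obtain ⟨F, hF, hadm⟩ := hQ.exists_isFlow hi
  exact ⟨hQ.notMem_spectrum (by simp), hQ.neg_I_notMem, F, hF, fun F' hF' => hF'.unique hF,
    fun t k => (hadm t).seq k, Quadruple.isDGHM_of_flow hi hF.alpha_const hadm hF.lam_deriv⟩
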